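/- \textbf{Conventions.} Let $\mathcal A$ be a finite set with the discrete $\sigma$-algebra. $\mathbf{Meas}$ is the category of measurable spaces and measurable maps. $\mathbb S$ (resp. $\mathbb P$) is the sub-probability (resp. probability) monad on $\mathbf{Meas}$: $TX$ is the set of all sub-probability (resp. probability) measures on $X$ with the smallest $\sigma$-algebra making all evaluations $P\mapsto P(S)$, $S$ measurable, measurable; $T(f)(P)=P\circ f^{-1}$, the unit is $\eta_X(x)=\delta_x$ and the multiplication is $\mu_X(P)(S)=\int Q(S)\,dP(Q)$. Let $\mathbf 1=\{\checkmark\}$, and let $F$ be the endofunctor $\mathcal A\times\mathrm{Id}$ or $\mathcal A\times\mathrm{Id}+\mathbf 1$ of $\mathbf{Meas}$. Let $\lambda: FT\Rightarrow TF$ be the distributive law $\lambda_X(a,P)=\delta_a\otimes P$ (regarded as a measure on $\mathcal A\times X+\mathbf 1$ concentrated on $\mathcal A\times X$ if $F=\mathcal A\times\mathrm{Id}+\mathbf 1$), $\lambda_X(\checkmark)=\delta_\checkmark$, and let $\overline F$ be the induced lifting of $F$ to the Kleisli category $\mathcal K\ell(T)$, i.e. $\overline FX=FX$ and $\overline F(f)=\lambda_Y\circ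 F(f)$ for $f:X\to TY$. For a type $\diamond\in\{0,*,\omega,\infty\}$ let $T$, $F$ and the measurable space $\Omega$ be \[ \begin{array}{c|c|l|l} \diamond & T & F & \Omega\\\hline 0 & \mathbb S & \mathcal A\times\mathrm{Id} & \emptyset\\ * & \mathbb S & \mathcal A\times\mathrm{Id}+\mathbf 1 & \mathcal A^*\\ \omega & \mathbb P & \mathcal A\times\mathrm{Id} & \mathcal A^\omega\\ \infty & \mathbb P & \mathcal A\times\mathrm{Id}+\mathbf 1 & \mathcal A^\infty=\mathcal A^*\cup\mathcal A^\omega \end{array} \] where $\Omega$ carries the $\sigma$-algebra generated by $\mathcal S_\diamond$: $\mathcal S_0=\{\emptyset\}$; $\mathcal S_*$ consists of $\emptyset$ and the singletons $\{u\}$; $\mathcal S_\omega$ of $\emptyset$ and the cones $u\mathcal A^\omega$ (infinite words with prefix $u$); $\mathcal S_\infty$ of $\emptyset$, the singletons $\{u\}$ and the cones $u\mathcal A^\infty$ (finite and infinite words with prefix $u$), where always $u\in\mathcal A^*$. A PTS of type $\diamond$ is a measurable space $X$ with a measurable transition function $\alpha:X\to T(FX)$. For $a\in\mathcal A$ put $\mathbf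 P_a(x,S)=\alpha(x)(\{a\}\times S)$. The trace measures of $(X,\alpha)$ are measures $\mathbf{tr}(x)$ on $\Omega$, $x\in X$, such that for all $x\in X$, $a\in\mathcal A$, $u\in\mathcal A^*$: $\mathbf{tr}(x)(\emptyset)=0$; if $\diamond\in\{*,\infty\}$, $\mathbf{tr}(x)(\{\varepsilon\})=\alpha(x)(\mathbf 1)$ and $\mathbf{tr}(x)(\{au\})=\int_X\mathbf{tr}(x')(\{u\})\,\mathbf P_a(x,dx')$; if $\diamond\in\{\omega,\infty\}$, $\mathbf{tr}(x)(\varepsilon\mathcal A^\diamond)=1$ and $\mathbf{tr}(x)(au\mathcal A^\diamond)=\int_X\mathbf{tr}(x')(u\mathcal A^\diamond)\,\mathbf P_a(x,dx')$. \textbf{Theorem (Final Coalgebra and Trace Semantics for PTS).} For each type $\diamond\in\{0,*,\omega,\infty\}$: \begin{enumerate} \item The PTS of type $\diamond$ are exactly the $\overline F$-coalgebras in $\mathcal K\ell(T)$: sending a PTS $(X,\alpha)$ to the coalgebra with carrier $X$ and structure arrow $\alpha$ is a bijection. \item The map $\phi:\Omega\to F\Omega$, $\varepsilon\mapsto\checkmark$,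 $au\mapsto(a,u)$ (the empty map for $\diamond=0$) is an isomorphism in $\mathbf{Meas}$, and $(\Omega,\kappa)$ with $\kappa=\eta_{F\Omega}\circ\phi$ is a final $\overline F$-coalgebra in $\mathcal K\ell(T)$. \item For every PTS $(X,\alpha)$ of type $\diamond$ there is exactly one family $(\mathbf{tr}(x))_{x\in X}$ of trace measures, and the unique $\overline F$-coalgebra homomorphism from $(X,\alpha)$ to $(\Omega,\kappa)$ is the map $\mathbf{tr}:X\to T\Omega$. \end{enumerate} -/

import Mathlib

universe u v w

open CategoryTheory MeasureTheory
open scoped ENNReal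

namespace TraceSemantics

/-! ### Distributive laws and the induced lifting to the Kleisli category -/

section Lifting

variable {C : Type v} [Category.{w} C]

/-- A distributive law `λ : FT ⇒ TF` of the endofunctor `F` over the monad `T`. -/
structure DistribLaw (T : Monad C) (F : C ⥤ C) where
  trans : T.toFunctor ⋙ F ⟶ F ⋙ T.toFunctor
  unit : ∀ X : C, F.map (T.η.app X) ≫ trans.app X = T.η.app (F.obj X)
  mult : ∀ X : C, trans.app (T.obj X) ≫ T.map (trans.app X) ≫ T.μ.app (F.obj X) =
    F.map (T.μ.app X) ≫ trans.app X

/-- The lifting `F̄` of `F` to the Kleisli category: `F̄ X = F X` on objects and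
`F̄ f = λ_Y ∘ F f` on a Kleisli arrow `f : X → T Y`. -/
def DistribLaw.lift {T : Monad C} {F : C ⥤ C} (l : DistribLaw T F) :
    Kleisli T ⥤ Kleisli T where
  obj X := Kleisli.mk T (F.obj X.of)
  map {_ Y} f := Kleisli.Hom.mk (F.map f.of ≫ l.trans.app Y.of)
  map_id X := by
    apply Kleisli.hom_ext
    exact l.unit X.of
  map_comp {X Y Z} f g := by
    apply Kleisli.hom_ext
    change F.map (f.of ≫ T.map g.of ≫ T.μ.app Z.of) ≫ l.trans.app Z.of =
      (F.map f.of ≫ l.trans.app Y.of) ≫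
        T.map (F.map g.of ≫ l.trans.app Z.of) ≫ T.μ.app (F.obj Z.of)
    have hn := l.trans.naturality g.of
    simp only [Functor.comp_map] at hn
    simp only [Functor.map_comp, Category.assoc]
    rw [← reassoc_of% hn, l.mult]

end Lifting

/-! ### The sub-probability monad and the probability monad -/

/-- The two kinds of probabilistic branching: by sub-probability measures or by
probability measures. -/
inductive Branching
  | sub
  | prob

/-- The condition on the total mass of a measure. -/
def Branching.Mass : Branching → ℝ≥0∞ → Prop
  | .sub, r => r ≤ 1
  | .prob, r => r = 1

theorem Branching.Mass.le_one {b : Branching} {r : ℝ≥0∞} (h : b.Mass r) : r ≤ 1 := by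
  cases b
  · exact h
  · exact le_of_eq h

theorem Branching.mass_one (b : Branching) : b.Mass 1 := by
  cases b
  · exact le_refl (1 : ℝ≥0∞)
  · exact rfl

/-- The sub-probability measures (`b = sub`), respectively the probability measures
(`b = prob`), on `X`. -/
@[ext]
structure PMeas (b : Branching) (X : Type u) [MeasurableSpace X] : Type u where
  meas : Measure X
  mass : b.Mass (meas Set.univ)

/-- The σ-algebra on `PMeas b X`, induced from the one on `Measure X`. It is the smallest one
that makes all evaluations `P ↦ P S` at measurable sets `S` measurable. -/
instance (b : Branching) (X : Type u) [MeasurableSpace X] : MeasurableSpace (PMeas b X) :=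
  MeasurableSpace.comap PMeas.meas inferInstance

namespace PMeas

variable {b : Branching} {X Y Z : Type u} [MeasurableSpace X] [MeasurableSpace Y]
  [MeasurableSpace Z]

theorem measurable_meas : Measurable (PMeas.meas : PMeas b X → Measure X) :=
  comap_measurable _

theorem measurable_mk {W : Type*} [MeasurableSpace W] {f : W → PMeas b X}
    (h : Measurable fun z => (f z).meas) : Measurable f :=
  measurable_comap_iff.mpr h

theorem measurable_eval {S : Set X} (hS : MeasurableSet S) :
    Measurable fun Q : PMeas b X => Q.meas S :=
  (Measure.measurable_coe hS).comp measurable_meas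

instance (P : PMeas b X) : IsFiniteMeasure P.meas :=
  ⟨lt_of_le_of_lt P.mass.le_one ENNReal.one_lt_top⟩

theorem ext_apply {P Q : PMeas b X} (h : ∀ S, MeasurableSet S → P.meas S = Q.meas S) : P = Q :=
  PMeas.ext (Measure.ext h)

/-- The image measure `P ∘ f⁻¹`. -/
noncomputable def map (f : X → Y) (hf : Measurable f) (P : PMeas b X) : PMeas b Y :=
  ⟨P.meas.map f, by rw [Measure.map_apply hf MeasurableSet.univ]; exact P.mass⟩

theorem measurable_map (f : X → Y) (hf : Measurable f) : Measurable (map (b := b) f hf) :=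
  measurable_mk ((Measure.measurable_map f hf).comp measurable_meas)

theorem map_apply (f : X → Y) (hf : Measurable f) (P : PMeas b X) {S : Set Y}
    (hS : MeasurableSet S) : (P.map f hf).meas S = P.meas (f ⁻¹' S) :=
  Measure.map_apply hf hS

theorem lintegral_map (f : X → Y) (hf : Measurable f) (P : PMeas b X) {g : Y → ℝ≥0∞}
    (hg : Measurable g) : ∫⁻ y, g y ∂(P.map f hf).meas = ∫⁻ x, g (f x) ∂P.meas :=
  MeasureTheory.lintegral_map hg hf

theorem map_id (P : PMeas b X) : P.map id measurable_id = P :=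
  PMeas.ext Measure.map_id

theorem map_comp (f : X → Y) (hf : Measurable f) (g : Y → Z) (hg : Measurable g)
    (P : PMeas b X) : P.map (g ∘ f) (hg.comp hf) = (P.map f hf).map g hg :=
  PMeas.ext (Measure.map_map hg hf).symm

/-- The Dirac measure. -/
noncomputable def dirac (x : X) : PMeas b X :=
  ⟨Measure.dirac x, by rw [measure_univ]; exact b.mass_one⟩

theorem measurable_dirac : Measurable (dirac (b := b) (X := X)) :=
  measurable_mk Measure.measurable_dirac

theorem dirac_apply (x : X) {S : Set X} (hS : MeasurableSet S) :
    (dirac (b := b) x).meas S = S.indicator 1 x :=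
  Measure.dirac_apply' x hS

theorem lintegral_dirac (x : X) {g : X → ℝ≥0∞} (hg : Measurable g) :
    ∫⁻ y, g y ∂(dirac (b := b) x).meas = g x :=
  lintegral_dirac' x hg

theorem map_dirac (f : X → Y) (hf : Measurable f) (x : X) :
    (dirac (b := b) x).map f hf = dirac (f x) :=
  PMeas.ext (Measure.map_dirac' hf x)

theorem join_mass (P : PMeas b (PMeas b X)) : b.Mass ((P.meas.bind PMeas.meas) Set.univ) := by
  rw [Measure.bind_apply MeasurableSet.univ measurable_meas.aemeasurable]
  have hP := P.mass
  cases b with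
  | sub =>
    calc ∫⁻ Q : PMeas .sub X, Q.meas Set.univ ∂P.meas ≤ ∫⁻ _ : PMeas .sub X, 1 ∂P.meas :=
          lintegral_mono fun Q => Q.mass
      _ = P.meas Set.univ := by simp
      _ ≤ 1 := hP
  | prob =>
    have h : ∀ Q : PMeas .prob X, Q.meas Set.univ = 1 := fun Q => Q.mass
    simp only [h, lintegral_one]
    exact hP

/-- The multiplication of the monad: `(join P)(S) = ∫ Q(S) dP(Q)`. -/
noncomputable def join (P : PMeas b (PMeas b X)) : PMeas b X :=
  ⟨P.meas.bind PMeas.meas, join_mass P⟩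

theorem measurable_join : Measurable (join (b := b) (X := X)) :=
  measurable_mk ((Measure.measurable_bind' measurable_meas).comp measurable_meas)

theorem join_apply (P : PMeas b (PMeas b X)) {S : Set X} (hS : MeasurableSet S) :
    P.join.meas S = ∫⁻ Q, Q.meas S ∂P.meas :=
  Measure.bind_apply hS measurable_meas.aemeasurable

theorem lintegral_join (P : PMeas b (PMeas b X)) {g : X → ℝ≥0∞} (hg : Measurable g) :
    ∫⁻ x, g x ∂P.join.meas = ∫⁻ Q, ∫⁻ x, g x ∂Q.meas ∂P.meas :=
  Measure.lintegral_bind measurable_meas.aemeasurable hg.aemeasurable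

theorem join_map_map (f : X → Y) (hf : Measurable f) (P : PMeas b (PMeas b X)) :
    (P.map (map f hf) (measurable_map f hf)).join = P.join.map f hf := by
  refine ext_apply fun S hS => ?_
  rw [join_apply _ hS, map_apply _ _ _ hS, join_apply _ (hf hS),
    lintegral_map _ _ _ (measurable_eval hS)]
  exact lintegral_congr fun Q => map_apply _ _ _ hS

theorem join_map_join (P : PMeas b (PMeas b (PMeas b X))) :
    (P.map join measurable_join).join = P.join.join := by
  refine ext_apply fun S hS => ?_
  rw [join_apply _ hS, join_apply _ hS, lintegral_map _ _ _ (measurable_eval hS),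
    lintegral_join _ (measurable_eval hS)]
  exact lintegral_congr fun Q => join_apply _ hS

theorem join_dirac (P : PMeas b X) : (dirac (b := b) P).join = P := by
  refine ext_apply fun S hS => ?_
  rw [join_apply _ hS, lintegral_dirac _ (measurable_eval hS)]

theorem join_map_dirac (P : PMeas b X) : (P.map dirac (measurable_dirac (b := b))).join = P := by
  refine ext_apply fun S hS => ?_
  rw [join_apply _ hS, lintegral_map _ _ _ (measurable_eval hS)]
  simp only [dirac_apply _ hS]
  exact lintegral_indicator_one hS

end PMeas

/-- The sub-probability monad (`b = sub`), respectively the probability (Giry) monad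
(`b = prob`), on the category of measurable spaces. -/
noncomputable def giry (b : Branching) : Monad MeasCat.{u} where
  obj X := MeasCat.of (PMeas b X)
  map f := ⟨PMeas.map f.1 f.2, PMeas.measurable_map f.1 f.2⟩
  map_id _ := Subtype.ext <| funext fun P => PMeas.map_id P
  map_comp f g := Subtype.ext <| funext fun P => PMeas.map_comp f.1 f.2 g.1 g.2 P
  η :=
    { app := fun _ => ⟨PMeas.dirac, PMeas.measurable_dirac⟩
      naturality := fun _ _ f => Subtype.ext <| funext fun x =>
        (PMeas.map_dirac f.1 f.2 x).symm }
  μ :=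
    { app := fun _ => ⟨PMeas.join, PMeas.measurable_join⟩
      naturality := fun _ _ f => Subtype.ext <| funext fun P => PMeas.join_map_map f.1 f.2 P }
  assoc _ := Subtype.ext <| funext fun P => PMeas.join_map_join P
  left_unit _ := Subtype.ext <| funext fun P => PMeas.join_dirac P
  right_unit _ := Subtype.ext <| funext fun P => PMeas.join_map_dirac P

/-! ### The endofunctors `A × Id` and `A × Id + 1` and their distributive laws -/

section Functors

variable (A : Type u) [MeasurableSpace A]

/-- The endofunctor `A × Id`. -/
def actFunctor : MeasCat.{u} ⥤ MeasCat.{u} where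
  obj X := MeasCat.of (A × X)
  map f := ⟨Prod.map id f.1, measurable_id.prodMap f.2⟩

/-- The endofunctor `A × Id + 1`; the element `✓` of `1` is `Sum.inr PUnit.unit`. -/
def actTermFunctor : MeasCat.{u} ⥤ MeasCat.{u} where
  obj X := MeasCat.of ((A × X) ⊕ PUnit.{u + 1})
  map f := ⟨Sum.map (Prod.map id f.1) id, (measurable_id.prodMap f.2).sumMap measurable_id⟩
  map_id _ := Subtype.ext <| funext fun z => by rcases z with z | z <;> rfl
  map_comp f g := Subtype.ext <| funext fun z => by rcases z with z | z <;> rfl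

variable {A} {b : Branching} {X Y : Type u} [MeasurableSpace X] [MeasurableSpace Y]

/-- The product measure `δ_a ⊗ P` on `A × X`. -/
noncomputable def diracProd (z : A × PMeas b X) : PMeas b (A × X) :=
  ⟨(Measure.dirac z.1).prod z.2.meas, by
    rw [Measure.dirac_prod, Measure.map_apply measurable_prodMk_left MeasurableSet.univ]
    exact z.2.mass⟩

theorem diracProd_eq (a : A) (P : PMeas b X) :
    diracProd (a, P) = P.map (Prod.mk a) measurable_prodMk_left :=
  PMeas.ext (Measure.dirac_prod a)

/-- The component at `X` of the distributive law for `A × Id + 1`: it maps `(a, P)` to the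
measure `δ_a ⊙ P`, that is `S ↦ (δ_a ⊗ P)(S ∩ (A × X))`, and `✓` to `δ_✓`. -/
noncomputable def diracProdTerm : (A × PMeas b X) ⊕ PUnit.{u + 1} →
    PMeas b ((A × X) ⊕ PUnit.{u + 1})
  | Sum.inl z => (diracProd z).map Sum.inl measurable_inl
  | Sum.inr t => PMeas.dirac (Sum.inr t)

theorem diracProd_natural (f : X → Y) (hf : Measurable f) (z : A × PMeas b X) :
    diracProd (Prod.map id (PMeas.map f hf) z) =
      (diracProd z).map (Prod.map id f) (measurable_id.prodMap hf) := by
  obtain ⟨a, P⟩ := z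
  simp only [Prod.map, id, diracProd_eq, ← PMeas.map_comp]
  rfl

theorem diracProd_unit (z : A × X) :
    diracProd (Prod.map id (PMeas.dirac (b := b)) z) = PMeas.dirac z := by
  obtain ⟨a, x⟩ := z
  simp only [Prod.map, id, diracProd_eq, PMeas.map_dirac]

theorem diracProdTerm_natural (f : X → Y) (hf : Measurable f)
    (z : (A × PMeas b X) ⊕ PUnit.{u + 1}) :
    diracProdTerm (Sum.map (Prod.map id (PMeas.map f hf)) id z) =
      (diracProdTerm z).map (Sum.map (Prod.map id f) id)
        ((measurable_id.prodMap hf).sumMap measurable_id) := by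
  rcases z with z | t
  · simp only [Sum.map_inl, diracProdTerm, diracProd_natural, ← PMeas.map_comp]
    rfl
  · simp only [Sum.map_inr, id, diracProdTerm, PMeas.map_dirac]

theorem diracProdTerm_unit (z : (A × X) ⊕ PUnit.{u + 1}) :
    diracProdTerm (Sum.map (Prod.map id (PMeas.dirac (b := b))) id z) = PMeas.dirac z := by
  rcases z with z | t
  · simp only [Sum.map_inl, diracProdTerm, diracProd_unit, PMeas.map_dirac]
  · rfl

variable [Finite A] [DiscreteMeasurableSpace A]

theorem measurable_diracProd : Measurable (diracProd : A × PMeas b X → PMeas b (A × X)) := by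
  refine measurable_from_prod_countable_right fun a => ?_
  simp only [diracProd_eq]
  exact PMeas.measurable_map _ _

theorem measurable_diracProdTerm : Measurable
    (diracProdTerm : (A × PMeas b X) ⊕ PUnit.{u + 1} → PMeas b ((A × X) ⊕ PUnit.{u + 1})) := by
  refine measurable_fun_sum ?_ ?_
  · exact (PMeas.measurable_map _ measurable_inl).comp measurable_diracProd
  · exact measurable_of_countable _

theorem diracProd_mult (z : A × PMeas b (PMeas b X)) :
    ((diracProd z).map diracProd measurable_diracProd).join =
      diracProd (Prod.map id PMeas.join z) := by
  obtain ⟨a, P⟩ := z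
  simp only [Prod.map, id, diracProd_eq, ← PMeas.map_comp, ← PMeas.join_map_map]
  congr 2
  funext Q
  exact diracProd_eq a Q

theorem diracProdTerm_mult (z : (A × PMeas b (PMeas b X)) ⊕ PUnit.{u + 1}) :
    ((diracProdTerm z).map diracProdTerm measurable_diracProdTerm).join =
      diracProdTerm (Sum.map (Prod.map id PMeas.join) id z) := by
  rcases z with z | t
  · simp only [Sum.map_inl, diracProdTerm, ← diracProd_mult, ← PMeas.map_comp,
      ← PMeas.join_map_map]
    rfl
  · simp only [Sum.map_inr, id, diracProdTerm, PMeas.map_dirac, PMeas.join_dirac]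

variable (A b)

/-- The distributive law `(a, P) ↦ δ_a ⊗ P` for `A × Id`. -/
noncomputable def actLaw : DistribLaw (giry.{u} b) (actFunctor A) where
  trans :=
    { app := fun _ => ⟨diracProd, measurable_diracProd⟩
      naturality := fun _ _ f => Subtype.ext <| funext fun z => diracProd_natural f.1 f.2 z }
  unit _ := Subtype.ext <| funext fun z => diracProd_unit z
  mult _ := Subtype.ext <| funext fun z => diracProd_mult z

/-- The distributive law `(a, P) ↦ δ_a ⊙ P`, `✓ ↦ δ_✓` for `A × Id + 1`. -/
noncomputable def actTermLaw : DistribLaw (giry.{u} b) (actTermFunctor A) where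
  trans :=
    { app := fun _ => ⟨diracProdTerm, measurable_diracProdTerm⟩
      naturality := fun _ _ f => Subtype.ext <| funext fun z =>
        diracProdTerm_natural f.1 f.2 z }
  unit _ := Subtype.ext <| funext fun z => diracProdTerm_unit z
  mult _ := Subtype.ext <| funext fun z => diracProdTerm_mult z

end Functors

/-! ### Probabilistic transition systems -/

/-- The four types `0`, `*`, `ω`, `∞` of probabilistic transition systems. -/
inductive PTSType
  | zero
  | star
  | omega
  | infty

namespace PTSType

/-- Types `0` and `*` branch by sub-probabilities, types `ω` and `∞` by probabilities. -/
def branching : PTSType → Branching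
  | zero => .sub
  | star => .sub
  | omega => .prob
  | infty => .prob

/-- Types `0` and `ω` have no termination, types `*` and `∞` have it. -/
def functor (A : Type u) [MeasurableSpace A] : PTSType → MeasCat.{u} ⥤ MeasCat.{u}
  | zero => actFunctor A
  | star => actTermFunctor A
  | omega => actFunctor A
  | infty => actTermFunctor A

/-- The monad of a type. -/
noncomputable abbrev monad (d : PTSType) : Monad MeasCat.{u} := giry d.branching

/-- The distributive law of a type. -/
noncomputable def law (A : Type u) [MeasurableSpace A] [Finite A] [DiscreteMeasurableSpace A] :
    (d : PTSType) → DistribLaw d.monad (d.functor A)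
  | zero => actLaw A _
  | star => actTermLaw A _
  | omega => actLaw A _
  | infty => actTermLaw A _

/-- The lifted endofunctor `F̄` on the Kleisli category of the monad. -/
noncomputable def liftedFunctor (A : Type u) [MeasurableSpace A] [Finite A]
    [DiscreteMeasurableSpace A] (d : PTSType) : Kleisli d.monad ⥤ Kleisli d.monad :=
  (d.law A).lift

/-- The map `x ↦ (a, x)` from `X` to `F X`. -/
def label {A : Type u} [MeasurableSpace A] (a : A) (X : MeasCat.{u}) :
    (d : PTSType) → X → (d.functor A).obj X
  | zero => fun x => ((a, x) : A × X)
  | star => fun x => (Sum.inl (a, x) : (A × X) ⊕ PUnit.{u + 1})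
  | omega => fun x => ((a, x) : A × X)
  | infty => fun x => (Sum.inl (a, x) : (A × X) ⊕ PUnit.{u + 1})

end PTSType

/-- A probabilistic transition system of type `d` over the alphabet `A`: a measurable state
space and a transition function which assigns measurably to every state a sub-probability
measure (types `0`, `*`) or probability measure (types `ω`, `∞`) on `A × X` (types `0`, `ω`)
or `A × X + 1` (types `*`, `∞`). -/
structure PTS (A : Type u) [MeasurableSpace A] (d : PTSType) where
  State : MeasCat.{u}
  step : State → Measure ((d.functor A).obj State)
  measurable_step : Measurable step
  mass_step : ∀ x, d.branching.Mass (step x Set.univ)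

namespace PTS

variable {A : Type u} [MeasurableSpace A] {d : PTSType}

/-- The measure `P_a(x, ·)` on states, `P_a(x, S) = α(x)({a} × S)`. -/
noncomputable def kernel (P : PTS A d) (a : A) (x : P.State) : Measure P.State :=
  (P.step x).comap (d.label a P.State)

theorem kernel_apply [DiscreteMeasurableSpace A] (P : PTS A d) (a : A) (x : P.State)
    {S : Set P.State} (hS : MeasurableSet S) :
    P.kernel a x S = P.step x (d.label a P.State '' S) := by
  have h1 : MeasurableEmbedding (Prod.mk a : P.State → A × P.State) :=
    measurableEmbedding_prodMk_left a
  have h2 : MeasurableEmbedding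
      (fun x => Sum.inl (a, x) : P.State → (A × P.State) ⊕ PUnit.{u + 1}) :=
    ⟨Sum.inl_injective.comp h1.injective, measurable_inl.comp h1.measurable, fun {S} hS => by
      rw [show (fun x => Sum.inl (a, x) : P.State → (A × P.State) ⊕ PUnit.{u + 1}) =
        Sum.inl ∘ Prod.mk a from rfl, Set.image_comp]
      exact (h1.measurableSet_image' hS).inl_image⟩
  cases d
  · exact h1.comap_apply _ S
  · exact h2.comap_apply _ S
  · exact h1.comap_apply _ S
  · exact h2.comap_apply _ S

/-- A PTS regarded as an `F̄`-coalgebra in the Kleisli category: same state space, same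
transition function. -/
noncomputable def toCoalgebra [Finite A] [DiscreteMeasurableSpace A] (P : PTS A d) :
    Endofunctor.Coalgebra (d.liftedFunctor A) where
  V := Kleisli.mk d.monad P.State
  str := Kleisli.Hom.mk
    ⟨fun x => ⟨P.step x, P.mass_step x⟩, PMeas.measurable_mk P.measurable_step⟩

end PTS

/-! ### Words, cones and the carriers of the final coalgebras -/

/-- Finite and infinite words. Finite words are lists, infinite words are streams. -/
inductive InftyWord (A : Type u) : Type u
  | fin (u : List A) : InftyWord A
  | inf (w : Stream' A) : InftyWord A

/-- The `ω`-cone of `u`: the infinite words with prefix `u`. -/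
def coneOmega {A : Type u} (u : List A) : Set (Stream' A) :=
  {w | ∀ (i : ℕ) (hi : i < u.length), w.get i = u[i]}

/-- The `∞`-cone of `u`: the finite and infinite words with prefix `u`. -/
def coneInfty {A : Type u} (u : List A) : Set (InftyWord A) :=
  {v | (∃ w : List A, u <+: w ∧ v = .fin w) ∨ ∃ w ∈ coneOmega u, v = .inf w}

/-! The semirings of sets of words for the types `0`, `*`, `ω`, `∞`. -/

def semiringZero : Set (Set PEmpty.{u + 1}) := {∅}

def semiringStar (A : Type u) : Set (Set (List A)) :=
  {∅} ∪ Set.range fun u : List A => {u}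

def semiringOmega (A : Type u) : Set (Set (Stream' A)) :=
  {∅} ∪ Set.range fun u : List A => coneOmega u

def semiringInfty (A : Type u) : Set (Set (InftyWord A)) :=
  {∅} ∪ (Set.range fun u : List A => {.fin u}) ∪ Set.range fun u : List A => coneInfty u

instance : MeasurableSpace PEmpty.{u + 1} := MeasurableSpace.generateFrom semiringZero

instance (A : Type u) : MeasurableSpace (List A) :=
  MeasurableSpace.generateFrom (semiringStar A)

instance (A : Type u) : MeasurableSpace (Stream' A) :=
  MeasurableSpace.generateFrom (semiringOmega A)

instance (A : Type u) : MeasurableSpace (InftyWord A) :=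
  MeasurableSpace.generateFrom (semiringInfty A)

/-- The carrier `Ω` of a type: no words, the finite words, the infinite words, the finite and
infinite words, each with the σ-algebra generated by the semiring. -/
def carrier (A : Type u) : PTSType → MeasCat.{u}
  | .zero => MeasCat.of PEmpty.{u + 1}
  | .star => MeasCat.of (List A)
  | .omega => MeasCat.of (Stream' A)
  | .infty => MeasCat.of (InftyWord A)

section Unfold

/-! The functions `φ : Ω → F Ω`, `ε ↦ ✓`, `a u ↦ (a, u)`. -/

def unfoldZero (A : Type u) : PEmpty.{u + 1} → A × PEmpty.{u + 1} := PEmpty.elim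

def unfoldStar {A : Type u} : List A → (A × List A) ⊕ PUnit.{u + 1}
  | [] => Sum.inr PUnit.unit
  | a :: u => Sum.inl (a, u)

def unfoldOmega {A : Type u} (w : Stream' A) : A × Stream' A := (w.head, w.tail)

def unfoldInfty {A : Type u} : InftyWord A → (A × InftyWord A) ⊕ PUnit.{u + 1}
  | .fin [] => Sum.inr PUnit.unit
  | .fin (a :: u) => Sum.inl (a, .fin u)
  | .inf w => Sum.inl (w.head, .inf w.tail)

theorem measurableSet_image_of_generator {Ω : Type u} [m : MeasurableSpace Ω] (G : Set (Set Ω))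
    (hG : m = MeasurableSpace.generateFrom G) (c : Ω → Ω) (hc : Function.Injective c)
    (hr : MeasurableSet (Set.range c)) (h : ∀ S ∈ G, MeasurableSet (c '' S)) (S : Set Ω)
    (hS : MeasurableSet S) : MeasurableSet (c '' S) := by
  subst hG
  induction S, hS using MeasurableSpace.generateFrom_induction with
  | hC S hS _ => exact h S hS
  | empty => simp
  | compl S _ ih => rw [Set.image_compl_eq_range_sdiff_image hc]; exact hr.diff ih
  | iUnion f _ ih => rw [Set.image_iUnion]; exact MeasurableSet.iUnion ih

/-- Prepending a letter to a finite or infinite word. -/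
def consInfty {A : Type u} (a : A) : InftyWord A → InftyWord A
  | .fin u => .fin (a :: u)
  | .inf w => .inf (Stream'.cons a w)

theorem consInfty_injective {A : Type u} (a : A) : Function.Injective (consInfty a) := by
  rintro (v | v) (w | w) h <;> simp only [consInfty, InftyWord.fin.injEq, InftyWord.inf.injEq,
    List.cons.injEq, true_and, reduceCtorEq] at h ⊢
  · exact h
  · exact Stream'.cons_injective_right a h

theorem consOmega_image {A : Type u} (a : A) (u : List A) :
    Stream'.cons a '' coneOmega u = coneOmega (a :: u) := by
  ext w
  constructor
  · rintro ⟨v, hv, rfl⟩ i hi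
    cases i with
    | zero => rfl
    | succ i => exact hv i (by simpa using hi)
  · intro hw
    have h0 : w.head = a := hw 0 (by simp)
    refine ⟨w.tail, fun i hi => hw (i + 1) (by simpa using hi), ?_⟩
    rw [← h0, Stream'.eta]

theorem consInfty_image {A : Type u} (a : A) (u : List A) :
    consInfty a '' coneInfty u = coneInfty (a :: u) := by
  ext w
  constructor
  · rintro ⟨v, ⟨x, hx, rfl⟩ | ⟨x, hx, rfl⟩, rfl⟩
    · exact Or.inl ⟨a :: x, List.cons_prefix_cons.mpr ⟨rfl, hx⟩, rfl⟩
    · exact Or.inr ⟨Stream'.cons a x, consOmega_image a u ▸ ⟨x, hx, rfl⟩, rfl⟩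
  · rintro (⟨x, hx, rfl⟩ | ⟨x, hx, rfl⟩)
    · obtain ⟨t, rfl⟩ := hx
      exact ⟨.fin (u ++ t), Or.inl ⟨_, List.prefix_append u t, rfl⟩, rfl⟩
    · rw [← consOmega_image] at hx
      obtain ⟨v, hv, rfl⟩ := hx
      exact ⟨.inf v, Or.inr ⟨v, hv, rfl⟩, rfl⟩

theorem coneOmega_nil {A : Type u} : coneOmega ([] : List A) = Set.univ :=
  Set.eq_univ_of_forall fun _ i hi => absurd hi (Nat.not_lt_zero i)

theorem coneInfty_nil {A : Type u} : coneInfty ([] : List A) = Set.univ := by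
  refine Set.eq_univ_of_forall fun w => ?_
  rcases w with w | w
  · exact Or.inl ⟨w, List.nil_prefix, rfl⟩
  · exact Or.inr ⟨w, coneOmega_nil ▸ Set.mem_univ w, rfl⟩

theorem measurableSet_coneOmega {A : Type u} (u : List A) : MeasurableSet (coneOmega u) :=
  MeasurableSpace.measurableSet_generateFrom (Or.inr ⟨u, rfl⟩)

theorem measurableSet_coneInfty {A : Type u} (u : List A) : MeasurableSet (coneInfty u) :=
  MeasurableSpace.measurableSet_generateFrom (Or.inr ⟨u, rfl⟩)

theorem measurableSet_fin {A : Type u} (u : List A) :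
    MeasurableSet ({.fin u} : Set (InftyWord A)) :=
  MeasurableSpace.measurableSet_generateFrom (Or.inl (Or.inr ⟨u, rfl⟩))

variable (A : Type u) [MeasurableSpace A]

theorem measurable_unfoldZero : Measurable (unfoldZero A) := measurable_of_empty _

theorem measurable_unfoldStar [Countable A] : Measurable (unfoldStar (A := A)) := by
  intro S _
  rw [← Set.biUnion_of_singleton (unfoldStar ⁻¹' S)]
  exact MeasurableSet.biUnion (Set.to_countable _) fun u _ =>
    MeasurableSpace.measurableSet_generateFrom (Or.inr ⟨u, rfl⟩)

theorem measurable_unfoldOmega [Countable A] : Measurable (unfoldOmega (A := A)) := by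
  intro S hS
  have hS' : unfoldOmega ⁻¹' S = ⋃ a : A, Stream'.cons a '' (Prod.mk a ⁻¹' S) := by
    ext w
    simp only [Set.mem_iUnion, Set.mem_image, Set.mem_preimage]
    constructor
    · intro hw
      exact ⟨w.head, w.tail, hw, Stream'.eta w⟩
    · rintro ⟨a, v, hv, rfl⟩
      exact hv
  rw [hS']
  refine MeasurableSet.iUnion fun a => ?_
  refine measurableSet_image_of_generator (semiringOmega A) rfl _
    (Stream'.cons_injective_right a) ?_ ?_ _ (measurable_prodMk_left hS)
  · rw [← Set.image_univ, ← coneOmega_nil, consOmega_image]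
    exact measurableSet_coneOmega _
  · rintro T (rfl | ⟨u, rfl⟩)
    · rw [Set.image_empty]; exact MeasurableSet.empty
    · simp only [consOmega_image]
      exact measurableSet_coneOmega _

theorem measurable_unfoldInfty [Countable A] : Measurable (unfoldInfty (A := A)) := by
  intro S hS
  have hS' : unfoldInfty ⁻¹' S =
      (⋃ a : A, consInfty a '' ((fun w => Sum.inl (a, w)) ⁻¹' S)) ∪
        {w | w = .fin [] ∧ Sum.inr PUnit.unit ∈ S} := by
    ext w
    simp only [Set.mem_union, Set.mem_iUnion, Set.mem_image, Set.mem_preimage, Set.mem_ofPred_eq]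
    constructor
    · intro hw
      rcases w with (_ | ⟨a, u⟩) | w
      · exact Or.inr ⟨rfl, hw⟩
      · exact Or.inl ⟨a, .fin u, hw, rfl⟩
      · exact Or.inl ⟨w.head, .inf w.tail, hw, congrArg InftyWord.inf (Stream'.eta w)⟩
    · rintro (⟨a, v | v, hv, rfl⟩ | ⟨rfl, hv⟩)
      · exact hv
      · exact hv
      · exact hv
  rw [hS']
  refine MeasurableSet.union (MeasurableSet.iUnion fun a => ?_) ?_
  · refine measurableSet_image_of_generator (semiringInfty A) rfl _
      (consInfty_injective a) ?_ ?_ _ ((measurable_inl.comp measurable_prodMk_left) hS)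
    · rw [← Set.image_univ, ← coneInfty_nil, consInfty_image]
      exact measurableSet_coneInfty _
    · rintro T ((rfl | ⟨u, rfl⟩) | ⟨u, rfl⟩)
      · rw [Set.image_empty]; exact MeasurableSet.empty
      · simp only [Set.image_singleton]
        exact measurableSet_fin (a :: u)
      · simp only [consInfty_image]
        exact measurableSet_coneInfty _
  · by_cases h : Sum.inr PUnit.unit ∈ S
    · simp only [h, and_true]
      exact measurableSet_fin []
    · simp only [h, and_false]
      exact MeasurableSet.empty

/-- The function `φ` as an arrow in the category of measurable spaces. -/
def unfold [Countable A] : (d : PTSType) → (carrier A d ⟶ (d.functor A).obj (carrier A d))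
  | .zero => ⟨unfoldZero A, measurable_unfoldZero A⟩
  | .star => ⟨unfoldStar, measurable_unfoldStar A⟩
  | .omega => ⟨unfoldOmega, measurable_unfoldOmega A⟩
  | .infty => ⟨unfoldInfty, measurable_unfoldInfty A⟩

variable [Finite A] [DiscreteMeasurableSpace A]

/-- The `F̄`-coalgebra `(Ω, κ)` with `κ = η_{FΩ} ∘ φ`. -/
noncomputable def wordCoalgebra (d : PTSType) : Endofunctor.Coalgebra (d.liftedFunctor A) where
  V := Kleisli.mk d.monad (carrier A d)
  str := Kleisli.Hom.mk (unfold A d ≫ d.monad.η.app _)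

/-- The function that assigns to each state the measure on words given by a Kleisli arrow from
the state space of a PTS to the carrier. -/
def kleisliMeasure {d : PTSType} {P : PTS A d}
    (f : P.toCoalgebra.V ⟶ (wordCoalgebra A d).V) : P.State → Measure (carrier A d) :=
  fun x => PMeas.meas (b := d.branching) (X := carrier A d) (f.of.1 x)

end Unfold

/-! ### The trace measure -/

/-- The defining equations of the trace measures `tr x` of the states `x` of a PTS; here `✓` is
`Sum.inr PUnit.unit`, and `P.kernel a x` is the measure `P_a(x, ·)`. -/
def IsTrace {A : Type u} [MeasurableSpace A] : (d : PTSType) → (P : PTS A d) →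
    (P.State → Measure (carrier A d)) → Prop
  | .zero, _, tr => ∀ x, tr x ∅ = 0
  | .star, P, tr => ∀ x, tr x ∅ = 0 ∧
      tr x ({[]} : Set (List A)) =
        P.step x ({Sum.inr PUnit.unit} : Set ((A × P.State) ⊕ PUnit.{u + 1})) ∧
      ∀ (a : A) (u : List A), tr x ({a :: u} : Set (List A)) =
        ∫⁻ x', tr x' ({u} : Set (List A)) ∂(P.kernel a x)
  | .omega, P, tr => ∀ x, tr x ∅ = 0 ∧
      tr x (coneOmega ([] : List A)) = 1 ∧
      ∀ (a : A) (u : List A), tr x (coneOmega (a :: u)) =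
        ∫⁻ x', tr x' (coneOmega u) ∂(P.kernel a x)
  | .infty, P, tr => ∀ x, tr x ∅ = 0 ∧
      tr x ({InftyWord.fin []} : Set (InftyWord A)) =
        P.step x ({Sum.inr PUnit.unit} : Set ((A × P.State) ⊕ PUnit.{u + 1})) ∧
      (∀ (a : A) (u : List A), tr x ({InftyWord.fin (a :: u)} : Set (InftyWord A)) =
        ∫⁻ x', tr x' ({InftyWord.fin u} : Set (InftyWord A)) ∂(P.kernel a x)) ∧
      tr x (coneInfty ([] : List A)) = 1 ∧
      ∀ (a : A) (u : List A), tr x (coneInfty (a :: u)) =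
        ∫⁻ x', tr x' (coneInfty u) ∂(P.kernel a x)

end TraceSemantics

open TraceSemantics

/-!
A coalgebra homomorphism `f` from a PTS to `(Ω, κ)` is the same thing as a family of trace measures,
so finality amounts to existence and uniqueness of trace measures.

Since `φ` is invertible in `Meas` with inverse `fold`, the homomorphisms are the fixed points of
the operator `unroll P`, `f ↦ T(φ⁻¹) ∘ F̄ f ∘ α`, "make one step, then continue with `f`"
(`DistribLaw.isHom_iff`, `isHom_iff_unroll_eq`). The measure `unroll P f x` takes on `{a u}` the
value `∫ f x' {u} dP_a(x, dx')`, on `{ε}` the value `α(x)(1)`, and similarly on cones. Hence fixed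
points satisfy the trace equations; conversely, if `f` satisfies them, `f x` and `unroll P f x`
agree on the generating semiring, which is a π-system, and so they are equal
(`isHom_iff_isTrace`).

The trace equations determine the values on the semiring by recursion on the word
(`PTS.weight`), which gives uniqueness (`IsTrace.unique`). For existence, iterate `unroll P` from an
arbitrary arrow `f₀`: after more than `|u|` steps the value on the generators indexed by `u` is the
prescribed weight (`PTS.eq_weight_of_lt`). In type `*` this shows that the weights of any finitely
many words sum to at most `1`, so the weights define a discrete sub-probability measure. In types
`ω` and `∞` words are encoded as points of the compact space `ℕ → A`, respectively
`ℕ → Option A`, where the generators are clopen. Probability measures on a compact space form a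
compact space, so the iterates have a weak limit point, and it takes the prescribed values on
clopen sets (`exists_measure_of_eventually_const`). In type `0` the zero measure is the only
measure on the empty space. The trace measures depend measurably on the
state because their values on the semiring do.
-/

namespace TraceSemantics

/-! ### Transition systems as coalgebras -/

theorem PTS.toCoalgebra_bijective (A : Type u) [MeasurableSpace A] [Finite A]
    [DiscreteMeasurableSpace A] (d : PTSType) : Function.Bijective
      (PTS.toCoalgebra : PTS A d → Endofunctor.Coalgebra (d.liftedFunctor A)) := by
  constructor
  · rintro ⟨X, s, hs, ms⟩ ⟨Y, t, ht, mt⟩ h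
    simp only [PTS.toCoalgebra, Endofunctor.Coalgebra.mk.injEq, Kleisli.mk.injEq] at h
    obtain ⟨rfl, h⟩ := h
    have h1 := congrArg Kleisli.Hom.of (eq_of_heq h)
    have h2 : ∀ x, s x = t x := fun x =>
      congrArg (PMeas.meas (b := d.branching) (X := (d.functor A).obj X))
        (congrFun (congrArg Subtype.val h1) x)
    obtain rfl : s = t := funext h2
    rfl
  · rintro ⟨⟨X⟩, ⟨g⟩⟩
    exact ⟨⟨X, fun x => PMeas.meas (b := d.branching) (X := (d.functor A).obj X) (g.1 x),
      PMeas.measurable_meas.comp g.2,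
      fun x => PMeas.mass (b := d.branching) (X := (d.functor A).obj X) (g.1 x)⟩, rfl⟩

/-! ### The inverse of `φ` -/

section Fold

variable {A : Type u}

instance [Countable A] : DiscreteMeasurableSpace (List A) := by
  have : MeasurableSingletonClass (List A) :=
    ⟨fun u => MeasurableSpace.measurableSet_generateFrom (Or.inr ⟨u, rfl⟩)⟩
  exact MeasurableSingletonClass.toDiscreteMeasurableSpace

theorem consInfty_left_injective {a b : A} {v w : InftyWord A}
    (h : consInfty a v = consInfty b w) : a = b := by
  rcases v with v | v <;> rcases w with w | w <;> simp [consInfty] at h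
  · exact h.1
  · exact congrArg Stream'.head h

theorem measurable_consOmega (a : A) : Measurable (Stream'.cons a) := by
  refine measurable_generateFrom ?_
  rintro _ (rfl | ⟨_ | ⟨b, u⟩, rfl⟩)
  · exact MeasurableSet.empty
  · simp only [coneOmega_nil, Set.preimage_univ, MeasurableSet.univ]
  · by_cases hab : a = b
    · subst hab
      simp only [← consOmega_image]
      rw [Set.preimage_image_eq _ (Stream'.cons_injective_right a)]
      exact measurableSet_coneOmega u
    · convert MeasurableSet.empty
      refine Set.eq_empty_of_forall_notMem fun w hw => hab ?_
      exact hw 0 (by simp)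

theorem measurable_consInfty (a : A) : Measurable (consInfty a) := by
  refine measurable_generateFrom ?_
  rintro _ ((rfl | ⟨_ | ⟨b, u⟩, rfl⟩) | ⟨_ | ⟨b, u⟩, rfl⟩)
  · exact MeasurableSet.empty
  · convert MeasurableSet.empty
    refine Set.eq_empty_of_forall_notMem fun w hw => ?_
    rcases w with w | w <;> simp [consInfty] at hw
  · by_cases hab : a = b
    · subst hab
      change MeasurableSet (consInfty a ⁻¹' {consInfty a (.fin u)})
      rw [← Set.image_singleton, Set.preimage_image_eq _ (consInfty_injective a)]
      exact measurableSet_fin u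
    · convert MeasurableSet.empty
      refine Set.eq_empty_of_forall_notMem fun w hw => hab ?_
      exact (consInfty_left_injective (w := .fin u) hw)
  · simp only [coneInfty_nil, Set.preimage_univ, MeasurableSet.univ]
  · by_cases hab : a = b
    · subst hab
      simp only [← consInfty_image]
      rw [Set.preimage_image_eq _ (consInfty_injective a)]
      exact measurableSet_coneInfty u
    · convert MeasurableSet.empty
      refine Set.eq_empty_of_forall_notMem fun w hw => hab ?_
      simp only [← consInfty_image] at hw
      obtain ⟨v, -, hv⟩ := hw
      exact (consInfty_left_injective hv).symm

variable (A) [MeasurableSpace A]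

/-- The inverse of `unfold`: `✓ ↦ ε`, `(a, u) ↦ a u`. -/
def fold [Countable A] [DiscreteMeasurableSpace A] :
    (d : PTSType) → ((d.functor A).obj (carrier A d) ⟶ carrier A d)
  | .zero => ⟨fun z : A × PEmpty.{u + 1} => z.2,
      measurable_snd (α := A) (β := PEmpty.{u + 1})⟩
  | .star => ⟨Sum.elim (fun z : A × List A => z.1 :: z.2) fun _ : PUnit.{u + 1} => [],
      (measurable_from_prod_countable_right fun a =>
        measurable_of_countable (List.cons a)).sumElim measurable_const⟩
  | .omega => ⟨fun z : A × Stream' A => Stream'.cons z.1 z.2,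
      measurable_from_prod_countable_right measurable_consOmega⟩
  | .infty => ⟨Sum.elim (fun z : A × InftyWord A => consInfty z.1 z.2)
      fun _ : PUnit.{u + 1} => .fin [],
      (measurable_from_prod_countable_right measurable_consInfty).sumElim measurable_const⟩

variable [Countable A] [DiscreteMeasurableSpace A] (d : PTSType)

theorem fold_leftInverse : Function.LeftInverse (fold A d).1 (unfold A d).1 := by
  intro w
  cases d
  · exact PEmpty.elim w
  · cases w <;> rfl
  · exact Stream'.eta w
  · rcases w with (_ | ⟨a, u⟩) | w
    · rfl
    · rfl
    · exact congrArg InftyWord.inf (Stream'.eta w)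

theorem fold_rightInverse : Function.RightInverse (fold A d).1 (unfold A d).1 := by
  intro z
  cases d
  · exact PEmpty.elim z.2
  · rcases z with z | z <;> rfl
  · rfl
  · rcases z with ⟨a, u | w⟩ | z <;> rfl

theorem unfold_fold : unfold A d ≫ fold A d = 𝟙 _ :=
  Subtype.ext <| funext <| fold_leftInverse A d

theorem fold_unfold : fold A d ≫ unfold A d = 𝟙 _ :=
  Subtype.ext <| funext <| fold_rightInverse A d

theorem isIso_unfold : IsIso (unfold A d) :=
  ⟨fold A d, unfold_fold A d, fold_unfold A d⟩

end Fold

/-! ### Generating π-systems of sets of words -/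

section Uniqueness

variable {A : Type u}

theorem coneOmega_inter_mem (u v : List A) : coneOmega u ∩ coneOmega v ∈ semiringOmega A := by
  induction u generalizing v with
  | nil => rw [coneOmega_nil, Set.univ_inter]; exact Or.inr ⟨v, rfl⟩
  | cons a u ih =>
    rcases v with _ | ⟨b, v⟩
    · rw [coneOmega_nil, Set.inter_univ]; exact Or.inr ⟨a :: u, rfl⟩
    · by_cases hab : a = b
      · subst hab
        rw [← consOmega_image, ← consOmega_image,
          ← Set.image_inter (Stream'.cons_injective_right a)]
        rcases ih v with h | ⟨w, h⟩
        · rw [h, Set.image_empty]; exact Or.inl rfl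
        · rw [← h, consOmega_image]; exact Or.inr ⟨_, rfl⟩
      · refine Or.inl (Set.eq_empty_of_forall_notMem ?_)
        rw [← consOmega_image, ← consOmega_image]
        rintro _ ⟨⟨v, -, rfl⟩, ⟨w, -, h⟩⟩
        exact hab (congrArg Stream'.head h).symm

theorem coneInfty_inter_mem (u v : List A) : coneInfty u ∩ coneInfty v ∈ semiringInfty A := by
  induction u generalizing v with
  | nil => rw [coneInfty_nil, Set.univ_inter]; exact Or.inr ⟨v, rfl⟩
  | cons a u ih =>
    rcases v with _ | ⟨b, v⟩
    · rw [coneInfty_nil, Set.inter_univ]; exact Or.inr ⟨a :: u, rfl⟩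
    · by_cases hab : a = b
      · subst hab
        rw [← consInfty_image, ← consInfty_image, ← Set.image_inter (consInfty_injective a)]
        rcases ih v with (h | ⟨w, h⟩) | ⟨w, h⟩
        · rw [h, Set.image_empty]; exact Or.inl (Or.inl rfl)
        · rw [← h, Set.image_singleton]; exact Or.inl (Or.inr ⟨a :: w, rfl⟩)
        · rw [← h, consInfty_image]; exact Or.inr ⟨_, rfl⟩
      · refine Or.inl (Or.inl (Set.eq_empty_of_forall_notMem ?_))
        rw [← consInfty_image, ← consInfty_image]
        rintro _ ⟨⟨v, -, rfl⟩, ⟨w, -, h⟩⟩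
        exact hab (consInfty_left_injective h).symm

theorem isPiSystem_semiringOmega : IsPiSystem (semiringOmega A) := by
  rintro _ (rfl | ⟨u, rfl⟩) _ (rfl | ⟨v, rfl⟩) h
  · simp at h
  · simp at h
  · simp at h
  · exact coneOmega_inter_mem u v

theorem isPiSystem_semiringInfty : IsPiSystem (semiringInfty A) := by
  rintro _ ((rfl | ⟨u, rfl⟩) | ⟨u, rfl⟩) _ ((rfl | ⟨v, rfl⟩) | ⟨v, rfl⟩) h
  · simp at h
  · simp at h
  · simp at h
  · simp at h
  · rw [Set.singleton_inter_of_mem (Set.singleton_inter_nonempty.mp h)]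
    exact Or.inl (Or.inr ⟨u, rfl⟩)
  · rw [Set.singleton_inter_of_mem (Set.singleton_inter_nonempty.mp h)]
    exact Or.inl (Or.inr ⟨u, rfl⟩)
  · simp at h
  · rw [Set.inter_singleton_of_mem (Set.inter_singleton_nonempty.mp h)]
    exact Or.inl (Or.inr ⟨v, rfl⟩)
  · exact coneInfty_inter_mem u v

/-- The cone of the empty word is the whole space, so the hypothesis `hμ` makes `μ` finite. -/
theorem measure_ext_omega {μ ν : Measure (Stream' A)} (hμ : μ (coneOmega []) = 1)
    (h : ∀ u, μ (coneOmega u) = ν (coneOmega u)) : μ = ν := by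
  refine Measure.ext_of_generateFrom_of_cover_subset (S := semiringOmega A)
    (T := {coneOmega []}) rfl isPiSystem_semiringOmega
    (Set.singleton_subset_iff.mpr (Or.inr ⟨[], rfl⟩))
    (Set.countable_singleton _) (by simp [coneOmega_nil]) ?_ ?_
  · rintro _ rfl
    exact hμ ▸ ENNReal.one_ne_top
  · rintro _ (rfl | ⟨u, rfl⟩)
    · rw [measure_empty, measure_empty]
    · exact h u

theorem measure_ext_infty {μ ν : Measure (InftyWord A)} (hμ : μ (coneInfty []) = 1)
    (h : ∀ u, μ {.fin u} = ν {.fin u}) (h' : ∀ u, μ (coneInfty u) = ν (coneInfty u)) :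
    μ = ν := by
  refine Measure.ext_of_generateFrom_of_cover_subset (S := semiringInfty A)
    (T := {coneInfty []}) rfl isPiSystem_semiringInfty
    (Set.singleton_subset_iff.mpr (Or.inr ⟨[], rfl⟩))
    (Set.countable_singleton _) (by simp [coneInfty_nil]) ?_ ?_
  · rintro _ rfl
    exact hμ ▸ ENNReal.one_ne_top
  · rintro _ ((rfl | ⟨u, rfl⟩) | ⟨u, rfl⟩)
    · rw [measure_empty, measure_empty]
    · exact h u
    · exact h' u

end Uniqueness

/-! ### Limits of probability measures on words -/

open Filter Topology in
/-- Let `Ω` be a measurable retract of a compact space `K`. If a sequence of probability measures on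
`Ω` is eventually constant on certain sets with clopen preimage in `K`, then one probability
measure attains all these eventual values: transport a weak limit point on `K` back to `Ω`. -/
theorem exists_measure_of_eventually_const {Ω K : Type*} [MeasurableSpace Ω] [TopologicalSpace K]
    [CompactSpace K] [T2Space K] [HasOuterApproxClosed K] [MeasurableSpace K] [BorelSpace K]
    {e : Ω → K} (he : Measurable e) {r : K → Ω} (hr : Measurable r)
    (hre : Function.LeftInverse r e) (ν : ℕ → Measure Ω) [hν : ∀ n, IsProbabilityMeasure (ν n)] :
    ∃ μ : Measure Ω, IsProbabilityMeasure μ ∧ ∀ S : Set Ω, MeasurableSet S → IsClopen (r ⁻¹' S) →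
      ∀ c : ℝ≥0∞, (∀ᶠ n in atTop, ν n S = c) → μ S = c := by
  let ρ : ℕ → ProbabilityMeasure K := fun n =>
    ⟨(ν n).map e, Measure.isProbabilityMeasure_map he.aemeasurable⟩
  -- An ultrafilter finer than `atTop` picks a limit point in the compact space of measures.
  let L : Ultrafilter (ProbabilityMeasure K) := (hyperfilter ℕ).map ρ
  have hL : Tendsto ρ (hyperfilter ℕ) (𝓝 L.lim) := L.le_nhds_lim
  refine ⟨(L.lim : Measure K).map r, Measure.isProbabilityMeasure_map hr.aemeasurable,
    fun S hS hclopen c hc => ?_⟩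
  have h1 := ProbabilityMeasure.tendsto_measure_of_null_frontier_of_tendsto' hL
    (E := r ⁻¹' S) (by rw [hclopen.frontier_eq, measure_empty])
  have h2 : Tendsto (fun n => (ρ n : Measure K) (r ⁻¹' S)) (hyperfilter ℕ) (𝓝 c) := by
    refine tendsto_const_nhds.congr' ?_
    filter_upwards [Nat.hyperfilter_le_atTop hc] with n hn
    change c = ((ν n).map e) (r ⁻¹' S)
    rw [Measure.map_apply he (hr hS), ← Set.preimage_comp, hre.comp_eq_id, Set.preimage_id]
    exact hn.symm
  rw [Measure.map_apply hr hS]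
  exact tendsto_nhds_unique h1 h2

section Topology

variable {A : Type u}

theorem isClopen_cylinder [TopologicalSpace A] [DiscreteTopology A] (u : List A) :
    IsClopen {f : ℕ → A | ∀ (i : ℕ) (hi : i < u.length), f i = u[i]} := by
  have : {f : ℕ → A | ∀ (i : ℕ) (hi : i < u.length), f i = u[i]} =
      ⋂ i : Fin u.length, (fun f => f i) ⁻¹' {u[i]} := by
    ext f
    simp [Fin.forall_iff]
  rw [this]
  exact isClopen_iInter_of_finite fun i => (isClopen_discrete _).preimage (continuous_apply _)

/-- The infinite word with the letters `f 0`, `f 1`, … up to the first `none`, or the infinite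
word of all letters if there is no `none`. -/
noncomputable def decode (f : ℕ → Option A) : InftyWord A :=
  open Classical in
  if h : ∃ n, f n = none then .fin ((List.range (Nat.find h)).filterMap f)
  else .inf fun n => (f n).get (Option.isSome_iff_ne_none.mpr fun hn => h ⟨n, hn⟩)

/-- The letters of a word, followed by `none` at all positions beyond its end. -/
def encode : InftyWord A → ℕ → Option A
  | .fin u, n => u[n]?
  | .inf w, n => some (w.get n)

theorem decode_of_none {f : ℕ → Option A} (h : f 0 = none) : decode f = .fin [] := by
  classical
  have h' : ∃ n, f n = none := ⟨0, h⟩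
  have : Nat.find h' = 0 := (Nat.find_eq_zero h').mpr h
  rw [decode, dif_pos h', this]
  rfl

theorem decode_of_some {f : ℕ → Option A} {a : A} (h : f 0 = some a) :
    decode f = consInfty a (decode fun n => f (n + 1)) := by
  classical
  by_cases h' : ∃ n, f (n + 1) = none
  · have h1 : ∃ n, f n = none := h'.imp' _ fun _ => id
    have h2 : Nat.find h1 = Nat.find h' + 1 := Nat.find_comp_succ h1 h' (by simp [h])
    rw [decode, dif_pos h1, decode, dif_pos h', h2, List.range_succ_eq_map, List.filterMap_cons, h,
      List.filterMap_map]
    rfl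
  · have h1 : ¬ ∃ n, f n = none := by
      rintro ⟨_ | n, hn⟩
      · simp [h] at hn
      · exact h' ⟨n, hn⟩
    rw [decode, dif_neg h1, decode, dif_neg h']
    refine congrArg InftyWord.inf ?_
    funext n
    cases n with
    | zero => simp [h, Stream'.cons]
    | succ n => rfl

/-- Not an equivalence: `decode` forgets all letters after the first `none`. -/
theorem decode_encode (w : InftyWord A) : decode (encode w) = w := by
  rcases w with u | w
  · induction u with
    | nil => exact decode_of_none rfl
    | cons a u ih => exact (decode_of_some (a := a) rfl).trans (congrArg (consInfty a) ih)
  · have h : ¬ ∃ n, encode (.inf w) n = none := by simp [encode]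
    rw [decode, dif_neg h]
    rfl

theorem preimage_decode_image_consInfty (a : A) (S : Set (InftyWord A)) :
    decode ⁻¹' (consInfty a '' S) =
      (fun f => f 0) ⁻¹' {some a} ∩ (fun f n => f (n + 1)) ⁻¹' (decode ⁻¹' S) := by
  ext f
  simp only [Set.mem_preimage, Set.mem_inter_iff, Set.mem_singleton_iff]
  constructor
  · rintro ⟨w, hw, hf⟩
    rcases h : f 0 with _ | b
    · rw [decode_of_none h] at hf
      rcases w with w | w <;> simp [consInfty] at hf
    · rw [decode_of_some h] at hf
      obtain rfl := consInfty_left_injective hf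
      exact ⟨rfl, consInfty_injective a hf ▸ hw⟩
  · rintro ⟨h, hf⟩
    exact ⟨_, hf, (decode_of_some h).symm⟩

/-- The induction step for the clopenness of the preimages of singletons and cones. -/
theorem isClopen_preimage_decode_image_consInfty
    [TopologicalSpace (Option A)] [DiscreteTopology (Option A)] (a : A) {S : Set (InftyWord A)}
    (hS : IsClopen (decode ⁻¹' S)) : IsClopen (decode ⁻¹' (consInfty a '' S)) := by
  rw [preimage_decode_image_consInfty]
  exact ((isClopen_discrete _).preimage (continuous_apply 0)).inter
    (hS.preimage (continuous_pi fun n => continuous_apply (n + 1)))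

theorem isClopen_preimage_decode_singleton
    [TopologicalSpace (Option A)] [DiscreteTopology (Option A)] (u : List A) :
    IsClopen (decode ⁻¹' {.fin u}) := by
  induction u with
  | nil =>
    have : decode ⁻¹' {.fin ([] : List A)} = (fun f => f 0) ⁻¹' {none} := by
      ext f
      simp only [Set.mem_preimage, Set.mem_singleton_iff]
      refine ⟨fun hf => ?_, decode_of_none⟩
      rcases h : f 0 with _ | b
      · rfl
      · rw [decode_of_some h] at hf
        rcases h' : decode fun n => f (n + 1) with v | v <;> simp [consInfty, h'] at hf
    rw [this]
    exact (isClopen_discrete _).preimage (continuous_apply 0)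
  | cons a u ih =>
    have := isClopen_preimage_decode_image_consInfty a ih
    rwa [Set.image_singleton] at this

theorem isClopen_preimage_decode_coneInfty
    [TopologicalSpace (Option A)] [DiscreteTopology (Option A)] (u : List A) :
    IsClopen (decode ⁻¹' coneInfty u) := by
  induction u with
  | nil => rw [coneInfty_nil]; exact isClopen_univ
  | cons a u ih => rw [← consInfty_image]; exact isClopen_preimage_decode_image_consInfty a ih

theorem measurable_get [Countable A] [MeasurableSpace A] (n : ℕ) :
    Measurable fun w : Stream' A => w.get n := by
  induction n with
  | zero => exact measurable_fst.comp (measurable_unfoldOmega A)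
  | succ n ih => exact ih.comp (measurable_snd.comp (measurable_unfoldOmega A))

theorem measurable_encode [Countable A] [MeasurableSpace A] [DiscreteMeasurableSpace A]
    [MeasurableSpace (Option A)] (n : ℕ) : Measurable fun w : InftyWord A => encode w n := by
  induction n with
  | zero =>
    have h : Measurable (Sum.elim (fun z : A × InftyWord A => some z.1)
        fun _ : PUnit.{u + 1} => none) :=
      ((Measurable.of_discrete (f := some)).comp measurable_fst).sumElim measurable_const
    convert h.comp (measurable_unfoldInfty A) using 1
    funext w
    rcases w with (_ | ⟨a, u⟩) | w <;> rfl
  | succ n ih =>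
    have h : Measurable (Sum.elim (fun z : A × InftyWord A => encode z.2 n)
        fun _ : PUnit.{u + 1} => none) := (ih.comp measurable_snd).sumElim measurable_const
    convert h.comp (measurable_unfoldInfty A) using 1
    funext w
    rcases w with (_ | ⟨a, u⟩) | w <;> rfl

open Filter in
/-- Infinite words are the points of `ℕ → A`, which is compact for the discrete topology on `A`. -/
theorem exists_measure_coneOmega [Finite A] (ν : ℕ → Measure (Stream' A))
    [∀ n, IsProbabilityMeasure (ν n)] (c : List A → ℝ≥0∞)
    (h : ∀ u, ∀ᶠ n in atTop, ν n (coneOmega u) = c u) :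
    ∃ μ : Measure (Stream' A), IsProbabilityMeasure μ ∧ ∀ u, μ (coneOmega u) = c u := by
  let : TopologicalSpace A := ⊥
  have : DiscreteTopology A := ⟨rfl⟩
  let : MeasurableSpace A := ⊤
  have he : Measurable fun (w : Stream' A) (n : ℕ) => w.get n :=
    measurable_pi_lambda _ measurable_get
  let r : (ℕ → A) → Stream' A := fun f => f
  have hr : Measurable r := by
    refine measurable_generateFrom ?_
    rintro _ (rfl | ⟨u, rfl⟩)
    · exact MeasurableSet.empty
    · exact (isClopen_cylinder u).isOpen.measurableSet
  obtain ⟨μ, hμ, hc⟩ := exists_measure_of_eventually_const he hr (r := r) (fun _ => rfl) ν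
  exact ⟨μ, hμ, fun u => hc _ (measurableSet_coneOmega u) (isClopen_cylinder u) _ (h u)⟩

open Filter in
/-- Finite and infinite words are a retract of the compact space `ℕ → Option A` by `encode` and
`decode`. -/
theorem exists_measure_coneInfty [Finite A] (ν : ℕ → Measure (InftyWord A))
    [∀ n, IsProbabilityMeasure (ν n)] (c c' : List A → ℝ≥0∞)
    (h : ∀ u, ∀ᶠ n in atTop, ν n {.fin u} = c u)
    (h' : ∀ u, ∀ᶠ n in atTop, ν n (coneInfty u) = c' u) :
    ∃ μ : Measure (InftyWord A), IsProbabilityMeasure μ ∧ (∀ u, μ {.fin u} = c u) ∧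
      ∀ u, μ (coneInfty u) = c' u := by
  let : TopologicalSpace (Option A) := ⊥
  have : DiscreteTopology (Option A) := ⟨rfl⟩
  let : MeasurableSpace (Option A) := ⊤
  let : MeasurableSpace A := ⊤
  have he : Measurable (encode (A := A)) := measurable_pi_lambda _ measurable_encode
  have hr : Measurable (decode (A := A)) := by
    refine measurable_generateFrom ?_
    rintro _ ((rfl | ⟨u, rfl⟩) | ⟨u, rfl⟩)
    · exact MeasurableSet.empty
    · exact (isClopen_preimage_decode_singleton u).isOpen.measurableSet
    · exact (isClopen_preimage_decode_coneInfty u).isOpen.measurableSet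
  obtain ⟨μ, hμ, hc⟩ := exists_measure_of_eventually_const he hr decode_encode ν
  exact ⟨μ, hμ, fun u => hc _ (measurableSet_fin u) (isClopen_preimage_decode_singleton u) _ (h u),
    fun u => hc _ (measurableSet_coneInfty u) (isClopen_preimage_decode_coneInfty u) _ (h' u)⟩

end Topology

/-! ### Weights of words and trace measures -/

section Trace

variable {A : Type u} [MeasurableSpace A]

theorem measurableEmbedding_label [DiscreteMeasurableSpace A] (d : PTSType) (a : A)
    (X : MeasCat.{u}) : MeasurableEmbedding (d.label a X) := by
  have h1 : MeasurableEmbedding (Prod.mk a : X → A × X) := measurableEmbedding_prodMk_left a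
  have h2 : MeasurableEmbedding (fun x => Sum.inl (a, x) : X → (A × X) ⊕ PUnit.{u + 1}) :=
    ⟨Sum.inl_injective.comp h1.injective, measurable_inl.comp h1.measurable, fun {S} hS => by
      rw [show (fun x => Sum.inl (a, x) : X → (A × X) ⊕ PUnit.{u + 1}) =
        Sum.inl ∘ Prod.mk a from rfl, Set.image_comp]
      exact (h1.measurableSet_image' hS).inl_image⟩
  cases d
  · exact h1
  · exact h2
  · exact h1
  · exact h2

namespace PTS

variable {d : PTSType}

/-- The kernel is a comapped measure, so it only sees the range of `label a`; the hypothesis `hg`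
makes the rest irrelevant for the integral on the right. -/
theorem lintegral_kernel [DiscreteMeasurableSpace A] (P : PTS A d) (a : A) (x : P.State)
    (g : (d.functor A).obj P.State → ℝ≥0∞) (hg : ∀ z ∉ Set.range (d.label a P.State), g z = 0) :
    ∫⁻ x', g (d.label a P.State x') ∂P.kernel a x = ∫⁻ z, g z ∂P.step x := by
  have h := measurableEmbedding_label d a P.State
  rw [← h.lintegral_map, kernel, h.map_comap]
  exact setLIntegral_eq_of_support_subset fun z hz => by
    by_contra hz'
    exact hz (hg z hz')

theorem measurable_kernel [DiscreteMeasurableSpace A] (P : PTS A d) (a : A) :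
    Measurable (P.kernel a) := by
  refine Measure.measurable_of_measurable_coe _ fun S hS => ?_
  simp only [P.kernel_apply a _ hS]
  exact (Measure.measurable_coe
    ((measurableEmbedding_label d a P.State).measurableSet_image' hS)).comp P.measurable_step

/-- Weights of finite words: `c x` for the empty word, and integrals over `P_a(x, ·)` for a word
that begins with the letter `a`. With `c x = α(x)(1)` this is the prescribed trace of the singleton
`{u}`, with `c x = 1` that of the cone of `u`. -/
noncomputable def weight (P : PTS A d) (c : P.State → ℝ≥0∞) : List A → P.State → ℝ≥0∞
  | [], x => c x
  | a :: u, x => ∫⁻ x', P.weight c u x' ∂P.kernel a x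

theorem measurable_weight [DiscreteMeasurableSpace A] (P : PTS A d) {c : P.State → ℝ≥0∞}
    (hc : Measurable c) (u : List A) : Measurable (P.weight c u) := by
  induction u with
  | nil => exact hc
  | cons a u ih => exact (Measure.measurable_lintegral ih).comp (P.measurable_kernel a)

theorem eq_weight (P : PTS A d) {c : P.State → ℝ≥0∞} {q : List A → P.State → ℝ≥0∞}
    (h0 : ∀ x, q [] x = c x) (h : ∀ a u x, q (a :: u) x = ∫⁻ x', q u x' ∂P.kernel a x)
    (u : List A) (x : P.State) : q u x = P.weight c u x := by
  induction u generalizing x with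
  | nil => exact h0 x
  | cons a u ih => simp only [h, ih, weight]

/-- The weights are reached after finitely many steps by every sequence `q` that satisfies the
recursion of the weights with a step index. -/
theorem eq_weight_of_lt (P : PTS A d) {c : P.State → ℝ≥0∞} {q : ℕ → List A → P.State → ℝ≥0∞}
    (h0 : ∀ n x, q (n + 1) [] x = c x)
    (h : ∀ n a u x, q (n + 1) (a :: u) x = ∫⁻ x', q n u x' ∂P.kernel a x)
    (u : List A) (n : ℕ) (hn : u.length < n) (x : P.State) : q n u x = P.weight c u x := by
  induction u generalizing n x with
  | nil => obtain ⟨n, rfl⟩ := Nat.exists_eq_succ_of_ne_zero hn.ne'; exact h0 n x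
  | cons a u ih =>
    obtain ⟨n, rfl⟩ := Nat.exists_eq_succ_of_ne_zero (Nat.ne_zero_of_lt hn)
    simp only [h, weight, ih n (Nat.lt_of_succ_lt_succ hn)]

end PTS

variable (P : PTS A .star) (Q : PTS A .omega) (R : PTS A .infty)

/-- The probability `α(x)(1)` of terminating at once, for the type `*`. -/
noncomputable def stopStar (x : P.State) : ℝ≥0∞ :=
  P.step x ({Sum.inr PUnit.unit} : Set ((A × P.State) ⊕ PUnit.{u + 1}))

/-- The probability `α(x)(1)` of terminating at once, for the type `∞`. -/
noncomputable def stopInfty (x : R.State) : ℝ≥0∞ :=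
  R.step x ({Sum.inr PUnit.unit} : Set ((A × R.State) ⊕ PUnit.{u + 1}))

theorem measurableSet_tick (X : MeasCat.{u}) :
    MeasurableSet ({Sum.inr PUnit.unit} : Set ((A × X) ⊕ PUnit.{u + 1})) := by
  rw [← Set.image_singleton]
  exact MeasurableSet.of_discrete.inr_image

theorem measurable_stopStar (P : PTS A .star) : Measurable (stopStar P) :=
  (Measure.measurable_coe (measurableSet_tick P.State)).comp P.measurable_step

theorem measurable_stopInfty (P : PTS A .infty) : Measurable (stopInfty P) :=
  (Measure.measurable_coe (measurableSet_tick P.State)).comp P.measurable_step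

theorem isTrace_star_iff (tr : P.State → Measure (List A)) :
    IsTrace .star P tr ↔ ∀ u x, tr x ({u} : Set (List A)) = P.weight (stopStar P) u x := by
  constructor
  · intro h
    exact P.eq_weight (q := fun u x => tr x ({u} : Set (List A))) (fun x => (h x).2.1)
      fun a u x => (h x).2.2 a u
  · intro h x
    refine ⟨measure_empty, h [] x, fun a u => ?_⟩
    exact (h (a :: u) x).trans (lintegral_congr fun x' => (h u x').symm)

theorem isTrace_omega_iff (tr : Q.State → Measure (Stream' A)) :
    IsTrace .omega Q tr ↔ ∀ u x, tr x (coneOmega u) = Q.weight (fun _ => 1) u x := by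
  constructor
  · intro h
    exact Q.eq_weight (q := fun u x => tr x (coneOmega u)) (fun x => (h x).2.1)
      fun a u x => (h x).2.2 a u
  · intro h x
    refine ⟨measure_empty, h [] x, fun a u => ?_⟩
    exact (h (a :: u) x).trans (lintegral_congr fun x' => (h u x').symm)

theorem isTrace_infty_iff (tr : R.State → Measure (InftyWord A)) :
    IsTrace .infty R tr ↔ (∀ u x, tr x {.fin u} = R.weight (stopInfty R) u x) ∧
      ∀ u x, tr x (coneInfty u) = R.weight (fun _ => 1) u x := by
  constructor
  · intro h
    exact ⟨R.eq_weight (q := fun u x => tr x {.fin u}) (fun x => (h x).2.1)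
      fun a u x => (h x).2.2.1 a u, R.eq_weight (q := fun u x => tr x (coneInfty u))
      (fun x => (h x).2.2.2.1) fun a u x => (h x).2.2.2.2 a u⟩
  · rintro ⟨h, h'⟩ x
    refine ⟨measure_empty, h [] x, fun a u => ?_, h' [] x, fun a u => ?_⟩
    · exact (h (a :: u) x).trans (lintegral_congr fun x' => (h u x').symm)
    · exact (h' (a :: u) x).trans (lintegral_congr fun x' => (h' u x').symm)

/-- No finiteness of the measures is assumed: the trace equations prescribe the total mass in the
types `ω` and `∞`, and the value on each of the countably many points in the type `*`. -/
theorem IsTrace.unique [Countable A] {d : PTSType} {P : PTS A d}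
    {tr tr' : P.State → Measure (carrier A d)} (h : IsTrace d P tr) (h' : IsTrace d P tr') :
    tr = tr' := by
  funext x
  cases d with
  | zero =>
    refine Measure.ext fun S _ => ?_
    rw [show S = ∅ from Set.eq_empty_of_forall_notMem fun w => PEmpty.elim w, measure_empty,
      measure_empty]
  | star =>
    replace h := (isTrace_star_iff P tr).mp h
    replace h' := (isTrace_star_iff P tr').mp h'
    exact Measure.ext_of_singleton (α := List A) fun u => (h u x).trans (h' u x).symm
  | omega =>
    replace h := (isTrace_omega_iff P tr).mp h
    replace h' := (isTrace_omega_iff P tr').mp h'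
    exact measure_ext_omega (h [] x) fun u => (h u x).trans (h' u x).symm
  | infty =>
    replace h := (isTrace_infty_iff P tr).mp h
    replace h' := (isTrace_infty_iff P tr').mp h'
    exact measure_ext_infty (h.2 [] x) (fun u => (h.1 u x).trans (h'.1 u x).symm)
      fun u => (h.2 u x).trans (h'.2 u x).symm

end Trace

/-! ### Homomorphisms as fixed points -/

section Coalgebra

variable {C : Type v} [Category.{w} C]

/-- If `φ : Ω → F Ω` is invertible in the base category, the homomorphisms from a coalgebra
`α` to `η ∘ φ` are the fixed points of `f ↦ T φ⁻¹ ∘ (F̄ f ∘ α)`. -/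
theorem DistribLaw.isHom_iff {T : Monad C} {F : C ⥤ C} (l : DistribLaw T F) {X W : C}
    (s : X ⟶ T.obj (F.obj X)) (p : W ⟶ F.obj W) (q : F.obj W ⟶ W) (hpq : p ≫ q = 𝟙 W)
    (hqp : q ≫ p = 𝟙 (F.obj W)) (f : X ⟶ T.obj W) :
    (Kleisli.Hom.mk s : Kleisli.mk T X ⟶ Kleisli.mk T (F.obj X)) ≫
        l.lift.map (Kleisli.Hom.mk f : Kleisli.mk T X ⟶ Kleisli.mk T W) =
      (Kleisli.Hom.mk f : Kleisli.mk T X ⟶ Kleisli.mk T W) ≫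
        (Kleisli.Hom.mk (p ≫ T.η.app _) : Kleisli.mk T W ⟶ Kleisli.mk T (F.obj W)) ↔
    (s ≫ T.map (F.map f ≫ l.trans.app W) ≫ T.μ.app (F.obj W)) ≫ T.map q = f := by
  have h : f ≫ T.map (p ≫ T.η.app _) ≫ T.μ.app _ = f ≫ T.map p := by
    rw [CategoryTheory.Functor.map_comp, Category.assoc, T.right_unit]
    exact congrArg (f ≫ ·) (Category.comp_id _)
  have h' : T.map p ≫ T.map q = 𝟙 _ := by
    rw [← CategoryTheory.Functor.map_comp, hpq, CategoryTheory.Functor.map_id]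
  have h'' : T.map q ≫ T.map p = 𝟙 _ := by
    rw [← CategoryTheory.Functor.map_comp, hqp, CategoryTheory.Functor.map_id]
  constructor
  · intro hf
    have hf' : s ≫ T.map (F.map f ≫ l.trans.app W) ≫ T.μ.app (F.obj W) =
      f ≫ T.map (p ≫ T.η.app _) ≫ T.μ.app _ := congrArg Kleisli.Hom.of hf
    rw [hf', h, Category.assoc, h', Category.comp_id]
  · intro hf
    apply Kleisli.hom_ext
    change s ≫ T.map (F.map f ≫ l.trans.app W) ≫ T.μ.app (F.obj W) =
      f ≫ T.map (p ≫ T.η.app _) ≫ T.μ.app _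
    rw [h]
    nth_rewrite 2 [← hf]
    rw [Category.assoc, h'', Category.comp_id]

end Coalgebra

section Unroll

variable {A : Type u} [MeasurableSpace A]

theorem label_notMem_image_label {d : PTSType} {X : MeasCat.{u}} {a b : A} (hab : b ≠ a) (x : X)
    (T : Set X) : d.label b X x ∉ d.label a X '' T := by
  rintro ⟨y, -, h⟩
  cases d
  · exact hab (congrArg Prod.fst h).symm
  · exact hab (congrArg Prod.fst (Sum.inl_injective h)).symm
  · exact hab (congrArg Prod.fst h).symm
  · exact hab (congrArg Prod.fst (Sum.inl_injective h)).symm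

/-- The distributive law for `A × Id + 1` puts no mass on `✓` except at `✓` itself. -/
theorem lintegral_diracProdTerm_tick {b : Branching} {X Y : Type u} [MeasurableSpace X]
    [MeasurableSpace Y] (k : X → PMeas b Y) (m : Measure ((A × X) ⊕ PUnit.{u + 1})) :
    ∫⁻ z, (diracProdTerm (Sum.map (Prod.map id k) id z)).meas {Sum.inr PUnit.unit} ∂m =
      m {Sum.inr PUnit.unit} := by
  have h : MeasurableSet ({Sum.inr PUnit.unit} : Set ((A × Y) ⊕ PUnit.{u + 1})) :=
    measurableSet_tick (MeasCat.of Y)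
  rw [← lintegral_indicator_one (measurableSet_tick (MeasCat.of X))]
  refine lintegral_congr fun z => ?_
  rcases z with z | t
  · refine (PMeas.map_apply Sum.inl measurable_inl _ h).trans ?_
    rw [show (Sum.inl ⁻¹' {Sum.inr PUnit.unit} : Set (A × Y)) = ∅ from
      Set.eq_empty_of_forall_notMem fun _ => Sum.inl_ne_inr, measure_empty]
    simp
  · refine (PMeas.dirac_apply _ h).trans ?_
    simp

variable [Finite A] [DiscreteMeasurableSpace A] {d : PTSType} {X Y : MeasCat.{u}}

/-- The function `λ_Y ∘ F g : F X → T (F Y)`. Here `g` is an arrow `X ⟶ T Y` written as a measurable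
function, a type to which it is definitionally equal. -/
noncomputable def lawMap (g : {g : X → PMeas d.branching Y // Measurable g})
    (z : (d.functor A).obj X) : PMeas d.branching ((d.functor A).obj Y) :=
  ((d.law A).trans.app Y).1 (((d.functor A).map (Y := d.monad.obj Y) g).1 z)

variable (g : {g : X → PMeas d.branching Y // Measurable g})

theorem measurable_lawMap : Measurable (lawMap (A := A) g) :=
  ((d.law A).trans.app Y).2.comp ((d.functor A).map (Y := d.monad.obj Y) g).2

/-- The distributive law sends `(a, P)` to the image of `P` under `label a`, in all four types. -/
theorem lawMap_label (a : A) (x : X) : lawMap g (d.label a X x) =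
    (g.1 x).map (d.label a Y) (measurableEmbedding_label d a Y).measurable := by
  cases d
  · exact diracProd_eq a _
  · exact (congrArg (PMeas.map Sum.inl measurable_inl) (diracProd_eq a _)).trans
      (PMeas.map_comp _ _ _ _ _).symm
  · exact diracProd_eq a _
  · exact (congrArg (PMeas.map Sum.inl measurable_inl) (diracProd_eq a _)).trans
      (PMeas.map_comp _ _ _ _ _).symm

theorem lawMap_label_apply (a b : A) (x : X) {T : Set Y} (hT : MeasurableSet T) :
    (lawMap g (d.label b X x)).meas (d.label a Y '' T) = (g.1 x).meas {y ∈ T | a = b} := by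
  have h := (measurableEmbedding_label d a Y).measurableSet_image' hT
  rw [lawMap_label, PMeas.map_apply _ _ _ h]
  congr 1
  ext y
  by_cases hab : b = a
  · subst hab
    simp [(measurableEmbedding_label d b Y).injective.mem_set_image]
  · simpa [Ne.symm hab] using label_notMem_image_label hab y T

theorem lawMap_apply_eq_zero (a : A) {z : (d.functor A).obj X}
    (hz : z ∉ Set.range (d.label a X)) {T : Set Y} (hT : MeasurableSet T) :
    (lawMap g z).meas (d.label a Y '' T) = 0 := by
  have key : ∀ b x, z = d.label b X x → (lawMap g z).meas (d.label a Y '' T) = 0 := by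
    rintro b x rfl
    have hab : a ≠ b := fun hab => hz (hab ▸ ⟨x, rfl⟩)
    rw [lawMap_label_apply g a b x hT]
    simp [hab]
  -- For `z = ✓` the law yields the Dirac measure at `✓`, in the types with termination.
  have tick : ∀ t : PUnit.{u + 1}, (PMeas.dirac (b := d.branching)
      (Sum.inr t : (A × Y) ⊕ PUnit.{u + 1})).meas ((fun y => Sum.inl (a, y)) '' T) = 0 := by
    intro t
    refine (PMeas.dirac_apply _ ((measurableEmbedding_label .star a Y).measurableSet_image'
      hT)).trans (Set.indicator_of_notMem ?_ _)
    rintro ⟨y, -, h⟩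
    cases h
  cases d
  · exact key z.1 z.2 rfl
  · rcases z with z | t
    · exact key z.1 z.2 rfl
    · exact tick t
  · exact key z.1 z.2 rfl
  · rcases z with z | t
    · exact key z.1 z.2 rfl
    · exact tick t

/-- The measure `(F̄ g ∘ α)(x)` on `F Y`, where `α` is the transition function of `P`. -/
noncomputable def stepMeasure (P : PTS A d)
    (g : {g : P.State → PMeas d.branching Y // Measurable g})
    (x : P.State) : PMeas d.branching ((d.functor A).obj Y) :=
  ((⟨P.step x, P.mass_step x⟩ : PMeas _ _).map (lawMap g) (measurable_lawMap g)).join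

theorem stepMeasure_apply (P : PTS A d) (g : {g : P.State → PMeas d.branching Y // Measurable g})
    (x : P.State) {S : Set ((d.functor A).obj Y)} (hS : MeasurableSet S) :
    (stepMeasure P g x).meas S = ∫⁻ z, (lawMap g z).meas S ∂P.step x :=
  (PMeas.join_apply _ hS).trans (PMeas.lintegral_map _ _ _ (PMeas.measurable_eval hS))

theorem measurable_stepMeasure (P : PTS A d)
    (g : {g : P.State → PMeas d.branching Y // Measurable g}) : Measurable (stepMeasure P g) :=
  PMeas.measurable_join.comp ((PMeas.measurable_map _ _).comp
    (PMeas.measurable_mk P.measurable_step))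

theorem stepMeasure_label (P : PTS A d) (g : {g : P.State → PMeas d.branching Y // Measurable g})
    (x : P.State) (a : A) {T : Set Y} (hT : MeasurableSet T) :
    (stepMeasure P g x).meas (d.label a _ '' T) = ∫⁻ x', (g.1 x').meas T ∂P.kernel a x := by
  rw [stepMeasure_apply P g x ((measurableEmbedding_label d a _).measurableSet_image' hT),
    ← P.lintegral_kernel a x _ fun z hz => lawMap_apply_eq_zero g a hz hT]
  refine lintegral_congr fun x' => ?_
  rw [lawMap_label_apply _ a a x' hT]
  simp only [and_true]
  rfl

theorem stepMeasure_tick_star (P : PTS A .star)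
    (g : {g : P.State → PMeas (PTSType.branching .star) Y // Measurable g}) (x : P.State) :
    (stepMeasure P g x).meas ({Sum.inr PUnit.unit} : Set ((A × Y) ⊕ PUnit.{u + 1})) =
      stopStar P x :=
  (stepMeasure_apply P g x (measurableSet_tick Y)).trans
    (lintegral_diracProdTerm_tick g.1 (P.step x))

theorem stepMeasure_tick_infty (P : PTS A .infty)
    (g : {g : P.State → PMeas (PTSType.branching .infty) Y // Measurable g}) (x : P.State) :
    (stepMeasure P g x).meas ({Sum.inr PUnit.unit} : Set ((A × Y) ⊕ PUnit.{u + 1})) =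
      stopInfty P x :=
  (stepMeasure_apply P g x (measurableSet_tick Y)).trans
    (lintegral_diracProdTerm_tick g.1 (P.step x))

variable (P : PTS A d) (f : {f : P.State → PMeas d.branching (carrier A d) // Measurable f})

/-- The Kleisli arrow obtained from `f` by making one step and continuing with `f`. -/
noncomputable def unroll : {f : P.State → PMeas d.branching (carrier A d) // Measurable f} :=
  ⟨fun x => (stepMeasure P f x).map (fold A d).1 (fold A d).2,
    (PMeas.measurable_map _ _).comp (measurable_stepMeasure P f)⟩

/-- The case of `DistribLaw.isHom_iff` for a PTS and `wordCoalgebra`. -/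
theorem isHom_iff_unroll_eq (f : P.toCoalgebra.V ⟶ (wordCoalgebra A d).V) :
    P.toCoalgebra.str ≫ (d.liftedFunctor A).map f = f ≫ (wordCoalgebra A d).str ↔
      unroll P f.of = f.of :=
  (d.law A).isHom_iff (X := P.State) (W := carrier A d) P.toCoalgebra.str.of (unfold A d)
    (fold A d) (unfold_fold A d) (fold_unfold A d) f.of

theorem unroll_apply (x : P.State) {S : Set (carrier A d)} (hS : MeasurableSet S) :
    ((unroll P f).1 x).meas S = (stepMeasure P f x).meas ((unfold A d).1 '' S) := by
  rw [Set.image_eq_preimage_of_inverse (fold_leftInverse A d) (fold_rightInverse A d)]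
  exact PMeas.map_apply (fold A d).1 (fold A d).2 _ hS

end Unroll

/-! ### Homomorphisms are the trace measures -/

section TraceHom

variable {A : Type u}

theorem meas_coneOmega_nil (Q : PMeas (PTSType.branching .omega) (carrier A .omega)) :
    Q.meas (coneOmega ([] : List A)) = 1 := by
  rw [coneOmega_nil]
  exact Q.mass

theorem meas_coneInfty_nil (Q : PMeas (PTSType.branching .infty) (carrier A .infty)) :
    Q.meas (coneInfty ([] : List A)) = 1 := by
  rw [coneInfty_nil]
  exact Q.mass

variable [MeasurableSpace A] [Finite A] [DiscreteMeasurableSpace A]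

section Star

variable (P : PTS A .star)
  (f : {f : P.State → PMeas (PTSType.branching .star) (carrier A .star) // Measurable f})

theorem unroll_star_nil (x : P.State) :
    ((unroll P f).1 x).meas ({[]} : Set (List A)) = stopStar P x := by
  rw [unroll_apply P f x (MeasurableSet.of_discrete (α := List A)), ← stepMeasure_tick_star P f x]
  exact congrArg (stepMeasure P f x).meas (Set.image_singleton (f := unfoldStar))

theorem unroll_star_cons (x : P.State) (a : A) (u : List A) :
    ((unroll P f).1 x).meas ({a :: u} : Set (List A)) =
      ∫⁻ x', (f.1 x').meas ({u} : Set (List A)) ∂P.kernel a x := by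
  rw [unroll_apply P f x (MeasurableSet.of_discrete (α := List A)),
    ← stepMeasure_label P f x a (MeasurableSet.of_discrete (α := List A))]
  refine congrArg (stepMeasure P f x).meas ((Set.image_singleton (f := unfoldStar)).trans ?_)
  exact (Set.image_singleton (f := fun u : List A => Sum.inl (a, u))).symm

end Star

section Omega

variable (P : PTS A .omega)
  (f : {f : P.State → PMeas (PTSType.branching .omega) (carrier A .omega) // Measurable f})

theorem unroll_omega_cons (x : P.State) (a : A) (u : List A) :
    ((unroll P f).1 x).meas (coneOmega (a :: u)) =
      ∫⁻ x', (f.1 x').meas (coneOmega u) ∂P.kernel a x := by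
  rw [unroll_apply P f x (measurableSet_coneOmega (a :: u)),
    ← stepMeasure_label P f x a (measurableSet_coneOmega u), ← consOmega_image]
  exact congrArg (stepMeasure P f x).meas (Set.image_image unfoldOmega _ _)

end Omega

section Infty

variable (P : PTS A .infty)
  (f : {f : P.State → PMeas (PTSType.branching .infty) (carrier A .infty) // Measurable f})

theorem unroll_infty_nil (x : P.State) :
    ((unroll P f).1 x).meas ({.fin []} : Set (InftyWord A)) = stopInfty P x := by
  rw [unroll_apply P f x (measurableSet_fin []), ← stepMeasure_tick_infty P f x]
  exact congrArg (stepMeasure P f x).meas (Set.image_singleton (f := unfoldInfty))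

theorem unroll_infty_consInfty (x : P.State) (a : A) {T S : Set (InftyWord A)}
    (hT : MeasurableSet T) (hS : MeasurableSet S) (h : consInfty a '' T = S) :
    ((unroll P f).1 x).meas S = ∫⁻ x', (f.1 x').meas T ∂P.kernel a x := by
  have hφ : unfoldInfty '' S = (fun w => Sum.inl (a, w)) '' T := by
    rw [← h, Set.image_image]
    refine Set.image_congr fun w _ => ?_
    rcases w with w | w <;> rfl
  rw [unroll_apply P f x hS, ← stepMeasure_label P f x a hT]
  exact congrArg (stepMeasure P f x).meas hφ

theorem unroll_infty_fin_cons (x : P.State) (a : A) (u : List A) :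
    ((unroll P f).1 x).meas ({.fin (a :: u)} : Set (InftyWord A)) =
      ∫⁻ x', (f.1 x').meas ({.fin u} : Set (InftyWord A)) ∂P.kernel a x :=
  unroll_infty_consInfty P f x a (measurableSet_fin u) (measurableSet_fin (a :: u))
    Set.image_singleton

theorem unroll_infty_cone_cons (x : P.State) (a : A) (u : List A) :
    ((unroll P f).1 x).meas (coneInfty (a :: u)) =
      ∫⁻ x', (f.1 x').meas (coneInfty u) ∂P.kernel a x :=
  unroll_infty_consInfty P f x a (measurableSet_coneInfty u) (measurableSet_coneInfty (a :: u))
    (consInfty_image a u)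

end Infty

theorem isTrace_of_unroll_eq {d : PTSType} (P : PTS A d)
    (f : {f : P.State → PMeas d.branching (carrier A d) // Measurable f}) (h : unroll P f = f) :
    IsTrace d P fun x => (f.1 x).meas := by
  have h' : ∀ x S, (f.1 x).meas S = ((unroll P f).1 x).meas S := fun x S => by rw [h]
  cases d
  · exact fun x => measure_empty
  · refine fun x => ⟨measure_empty, ?_, fun a u => ?_⟩
    · exact (h' x _).trans (unroll_star_nil P f x)
    · exact (h' x _).trans (unroll_star_cons P f x a u)
  · refine fun x => ⟨measure_empty, meas_coneOmega_nil _, fun a u => ?_⟩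
    exact (h' x _).trans (unroll_omega_cons P f x a u)
  · refine fun x => ⟨measure_empty, ?_, fun a u => ?_, meas_coneInfty_nil _, fun a u => ?_⟩
    · exact (h' x _).trans (unroll_infty_nil P f x)
    · exact (h' x _).trans (unroll_infty_fin_cons P f x a u)
    · exact (h' x _).trans (unroll_infty_cone_cons P f x a u)

theorem unroll_eq_of_isTrace {d : PTSType} (P : PTS A d)
    (f : {f : P.State → PMeas d.branching (carrier A d) // Measurable f})
    (h : IsTrace d P fun x => (f.1 x).meas) : unroll P f = f := by
  refine Subtype.ext (funext fun x => PMeas.ext ?_)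
  cases d
  · refine Measure.ext fun S _ => ?_
    rw [show S = ∅ from Set.eq_empty_of_forall_notMem fun w => PEmpty.elim w, measure_empty,
      measure_empty]
  · refine Measure.ext_of_singleton (α := List A) fun u => ?_
    rcases u with _ | ⟨a, u⟩
    · exact (unroll_star_nil P f x).trans (h x).2.1.symm
    · exact (unroll_star_cons P f x a u).trans ((h x).2.2 a u).symm
  · refine measure_ext_omega (meas_coneOmega_nil _) fun u => ?_
    rcases u with _ | ⟨a, u⟩
    · exact (meas_coneOmega_nil _).trans (h x).2.1.symm
    · exact (unroll_omega_cons P f x a u).trans ((h x).2.2 a u).symm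
  · refine measure_ext_infty (meas_coneInfty_nil _) (fun u => ?_) fun u => ?_
    · rcases u with _ | ⟨a, u⟩
      · exact (unroll_infty_nil P f x).trans (h x).2.1.symm
      · exact (unroll_infty_fin_cons P f x a u).trans ((h x).2.2.1 a u).symm
    · rcases u with _ | ⟨a, u⟩
      · exact (meas_coneInfty_nil _).trans (h x).2.2.2.1.symm
      · exact (unroll_infty_cone_cons P f x a u).trans ((h x).2.2.2.2 a u).symm

theorem isHom_iff_isTrace {d : PTSType} (P : PTS A d)
    (f : P.toCoalgebra.V ⟶ (wordCoalgebra A d).V) :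
    P.toCoalgebra.str ≫ (d.liftedFunctor A).map f = f ≫ (wordCoalgebra A d).str ↔
      IsTrace d P (kleisliMeasure A f) :=
  (isHom_iff_unroll_eq P f).trans
    ⟨isTrace_of_unroll_eq P f.of, unroll_eq_of_isTrace P f.of⟩

end TraceHom

/-! ### Existence of trace measures and finality -/

section Existence

variable {A : Type u} [MeasurableSpace A] [Finite A] [DiscreteMeasurableSpace A]

/-- The weights define a discrete measure. Its mass is at most `1`, because on every finite set of
words it coincides with an iterate of `unroll P` on the zero measures. -/
theorem exists_isTrace_star (P : PTS A .star) :
    ∃ f : {f : P.State → PMeas (PTSType.branching .star) (carrier A .star) // Measurable f},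
      IsTrace .star P fun x => (f.1 x).meas := by
  let f₀ : {f : P.State → PMeas (PTSType.branching .star) (carrier A .star) // Measurable f} :=
    ⟨fun _ => ⟨0, zero_le_one' ℝ≥0∞⟩, measurable_const⟩
  let f : ℕ → {f : P.State → PMeas (PTSType.branching .star) (carrier A .star) // Measurable f} :=
    fun n => (unroll P)^[n] f₀
  have hf : ∀ n, f (n + 1) = unroll P (f n) := fun n => Function.iterate_succ_apply' _ _ _
  have key := P.eq_weight_of_lt (c := stopStar P)
    (q := fun n u x => ((f n).1 x).meas ({u} : Set (List A)))
    (fun n x => by rw [hf]; exact unroll_star_nil P (f n) x)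
    (fun n a u x => by rw [hf]; exact unroll_star_cons P (f n) x a u)
  have hsum : ∀ (ν : Measure (List A)) (s : Finset (List A)), ∑ u ∈ s, ν {u} = ν s :=
    fun _ _ => sum_measure_singleton
  let m : P.State → Measure (List A) := fun x =>
    Measure.sum fun u => P.weight (stopStar P) u x • Measure.dirac u
  have hm : ∀ x u, m x {u} = P.weight (stopStar P) u x := by
    intro x u
    rw [Measure.sum_apply _ MeasurableSet.of_discrete, tsum_eq_single u]
    · simp
    · intro v hv
      simp [hv]
  have hmass : ∀ x, m x Set.univ ≤ 1 := by
    intro x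
    rw [Measure.sum_apply _ MeasurableSet.univ]
    simp only [Measure.smul_apply, measure_univ, smul_eq_mul, mul_one]
    rw [ENNReal.tsum_eq_iSup_sum]
    refine iSup_le fun s => ?_
    obtain ⟨n, hn⟩ : ∃ n, ∀ u ∈ s, u.length < n :=
      ⟨s.sup List.length + 1, fun u hu => Nat.lt_succ_of_le (Finset.le_sup hu)⟩
    calc ∑ u ∈ s, P.weight (stopStar P) u x
        = ∑ u ∈ s, ((f n).1 x).meas ({u} : Set (List A)) :=
          Finset.sum_congr rfl fun u hu => (key u n (hn u hu) x).symm
      _ = ((f n).1 x).meas (s : Set (List A)) :=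
          hsum _ s
      _ ≤ 1 := (measure_mono (Set.subset_univ _)).trans ((f n).1 x).mass.le_one
  have hmeas : Measurable m := by
    refine Measure.measurable_of_measurable_coe _ fun S hS => ?_
    simp only [m, Measure.sum_apply _ hS, Measure.smul_apply, smul_eq_mul]
    exact Measurable.tsum fun u =>
      (P.measurable_weight (measurable_stopStar P) u).mul_const _
  exact ⟨⟨fun x => ⟨m x, hmass x⟩, PMeas.measurable_mk hmeas⟩,
    (isTrace_star_iff P m).mpr fun u x => hm x u⟩

/-- Each trace measure is the limit, in the sense of `exists_measure_coneOmega`, of the iterates of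
`unroll P`. -/
theorem exists_isTrace_omega (P : PTS A .omega) :
    ∃ f : {f : P.State → PMeas (PTSType.branching .omega) (carrier A .omega) // Measurable f},
      IsTrace .omega P fun x => (f.1 x).meas := by
  -- The iteration needs a first arrow; if there is a state, its transition measure has mass `1`, so
  -- the alphabet and hence `Stream' A` are nonempty.
  have h₀ : Nonempty
      {f : P.State → PMeas (PTSType.branching .omega) (carrier A .omega) // Measurable f} := by
    rcases isEmpty_or_nonempty P.State with h | ⟨⟨x⟩⟩
    · exact ⟨⟨isEmptyElim, measurable_of_empty _⟩⟩
    · have hx : P.step x Set.univ = 1 := P.mass_step x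
      have hA : Nonempty (A × P.State) := by
        by_contra hA
        rw [not_nonempty_iff] at hA
        exact zero_ne_one (measure_empty.symm.trans
          ((congrArg (P.step x) (Set.univ_eq_empty_iff.mpr hA)).symm.trans hx))
      obtain ⟨a, -⟩ := hA
      exact ⟨⟨fun _ => PMeas.dirac (Stream'.const a), measurable_const⟩⟩
  obtain ⟨f₀⟩ := h₀
  let f : ℕ → {f : P.State → PMeas (PTSType.branching .omega) (carrier A .omega) //
    Measurable f} := fun n => (unroll P)^[n] f₀
  have hf : ∀ n, f (n + 1) = unroll P (f n) := fun n => Function.iterate_succ_apply' _ _ _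
  have key := P.eq_weight_of_lt (c := fun _ => 1)
    (q := fun n u x => ((f n).1 x).meas (coneOmega u))
    (fun n x => meas_coneOmega_nil _)
    (fun n a u x => by rw [hf]; exact unroll_omega_cons P (f n) x a u)
  have ex : ∀ x, ∃ μ : Measure (Stream' A), IsProbabilityMeasure μ ∧
      ∀ u, μ (coneOmega u) = P.weight (fun _ => 1) u x := by
    intro x
    let ν : ℕ → Measure (Stream' A) := fun n => ((f n).1 x).meas
    have : ∀ n, IsProbabilityMeasure (ν n) := fun n => ⟨((f n).1 x).mass⟩
    refine exists_measure_coneOmega ν _ fun u => ?_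
    filter_upwards [Filter.eventually_gt_atTop u.length] with n hn
    exact key u n hn x
  choose m hm hc using ex
  have hmeas : Measurable m := by
    refine Measurable.measure_of_isPiSystem_of_isProbabilityMeasure rfl
      isPiSystem_semiringOmega ?_
    rintro _ (rfl | ⟨u, rfl⟩)
    · simp only [measure_empty, measurable_const]
    · simp only [hc]
      exact P.measurable_weight measurable_const u
  exact ⟨⟨fun x => ⟨m x, (hm x).measure_univ⟩, PMeas.measurable_mk hmeas⟩,
    (isTrace_omega_iff P m).mpr fun u x => hc x u⟩

/-- Each trace measure is the limit, in the sense of `exists_measure_coneInfty`, of the iterates of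
`unroll P`. -/
theorem exists_isTrace_infty (P : PTS A .infty) :
    ∃ f : {f : P.State → PMeas (PTSType.branching .infty) (carrier A .infty) // Measurable f},
      IsTrace .infty P fun x => (f.1 x).meas := by
  let f₀ : {f : P.State → PMeas (PTSType.branching .infty) (carrier A .infty) // Measurable f} :=
    ⟨fun _ => PMeas.dirac (InftyWord.fin []), measurable_const⟩
  let f : ℕ → {f : P.State → PMeas (PTSType.branching .infty) (carrier A .infty) //
    Measurable f} := fun n => (unroll P)^[n] f₀
  have hf : ∀ n, f (n + 1) = unroll P (f n) := fun n => Function.iterate_succ_apply' _ _ _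
  have key := P.eq_weight_of_lt (c := stopInfty P)
    (q := fun n u x => ((f n).1 x).meas ({.fin u} : Set (InftyWord A)))
    (fun n x => by rw [hf]; exact unroll_infty_nil P (f n) x)
    (fun n a u x => by rw [hf]; exact unroll_infty_fin_cons P (f n) x a u)
  have key' := P.eq_weight_of_lt (c := fun _ => 1)
    (q := fun n u x => ((f n).1 x).meas (coneInfty u))
    (fun n x => meas_coneInfty_nil _)
    (fun n a u x => by rw [hf]; exact unroll_infty_cone_cons P (f n) x a u)
  have ex : ∀ x, ∃ μ : Measure (InftyWord A), IsProbabilityMeasure μ ∧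
      (∀ u, μ {.fin u} = P.weight (stopInfty P) u x) ∧
      ∀ u, μ (coneInfty u) = P.weight (fun _ => 1) u x := by
    intro x
    let ν : ℕ → Measure (InftyWord A) := fun n => ((f n).1 x).meas
    have : ∀ n, IsProbabilityMeasure (ν n) := fun n => ⟨((f n).1 x).mass⟩
    refine exists_measure_coneInfty ν _ _ (fun u => ?_) fun u => ?_
    · filter_upwards [Filter.eventually_gt_atTop u.length] with n hn
      exact key u n hn x
    · filter_upwards [Filter.eventually_gt_atTop u.length] with n hn
      exact key' u n hn x
  choose m hm hc hc' using ex
  have hmeas : Measurable m := by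
    refine Measurable.measure_of_isPiSystem_of_isProbabilityMeasure rfl
      isPiSystem_semiringInfty ?_
    rintro _ ((rfl | ⟨u, rfl⟩) | ⟨u, rfl⟩)
    · simp only [measure_empty, measurable_const]
    · simp only [hc]
      exact P.measurable_weight (measurable_stopInfty P) u
    · simp only [hc']
      exact P.measurable_weight measurable_const u
  exact ⟨⟨fun x => ⟨m x, (hm x).measure_univ⟩, PMeas.measurable_mk hmeas⟩,
    (isTrace_infty_iff P m).mpr ⟨fun u x => hc x u, fun u x => hc' x u⟩⟩

theorem exists_isTrace {d : PTSType} (P : PTS A d) :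
    ∃ f : P.toCoalgebra.V ⟶ (wordCoalgebra A d).V, IsTrace d P (kleisliMeasure A f) := by
  suffices h : ∃ f : {f : P.State → PMeas d.branching (carrier A d) // Measurable f},
      IsTrace d P fun x => (f.1 x).meas by
    obtain ⟨f, hf⟩ := h
    exact ⟨Kleisli.Hom.mk f, hf⟩
  cases d
  · exact ⟨⟨fun _ => ⟨0, zero_le_one' ℝ≥0∞⟩, measurable_const⟩, fun _ => measure_empty⟩
  · exact exists_isTrace_star P
  · exact exists_isTrace_omega P
  · exact exists_isTrace_infty P

theorem kleisliMeasure_injective {d : PTSType} (P : PTS A d) :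
    Function.Injective (kleisliMeasure A (P := P)) := by
  intro f g h
  apply Kleisli.hom_ext
  exact Subtype.ext (funext fun x => PMeas.ext (congrFun h x))

theorem nonempty_unique_hom (d : PTSType) (V : Endofunctor.Coalgebra (d.liftedFunctor A)) :
    Nonempty (Unique (V ⟶ wordCoalgebra A d)) := by
  obtain ⟨P, rfl⟩ := (PTS.toCoalgebra_bijective A d).surjective V
  obtain ⟨f, hf⟩ := exists_isTrace P
  refine ⟨⟨⟨⟨f, (isHom_iff_isTrace P f).mpr hf⟩⟩, fun g => ?_⟩⟩
  exact Endofunctor.Coalgebra.Hom.ext (kleisliMeasure_injective P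
    (((isHom_iff_isTrace P g.f).mp g.h).unique hf))

end Existence

end TraceSemantics

theorem mainTheorem1 {A : Type u} [Finite A] [MeasurableSpace A] [DiscreteMeasurableSpace A]
    (d : PTSType) :
    Function.Bijective
      (PTS.toCoalgebra : PTS A d → Endofunctor.Coalgebra (d.liftedFunctor A)) ∧
    IsIso (unfold A d) ∧
    ∃ hfin : Limits.IsTerminal (wordCoalgebra A d), ∀ P : PTS A d,
      (∃! tr : P.State → Measure (carrier A d), IsTrace d P tr) ∧
      IsTrace d P (kleisliMeasure A (hfin.from P.toCoalgebra).f) := by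
  refine ⟨PTS.toCoalgebra_bijective A d, isIso_unfold A d, ?_⟩
  let (V : Endofunctor.Coalgebra (d.liftedFunctor A)) : Unique (V ⟶ wordCoalgebra A d) :=
    (nonempty_unique_hom d V).some
  refine ⟨Limits.IsTerminal.ofUnique _, fun P => ?_⟩
  have hP : IsTrace d P
    (kleisliMeasure A ((Limits.IsTerminal.ofUnique (wordCoalgebra A d)).from P.toCoalgebra).f) :=
    (isHom_iff_isTrace P _).mp (Endofunctor.Coalgebra.Hom.h _)
  exact ⟨⟨_, hP, fun tr htr => htr.unique hP⟩, hP⟩
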